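/- An instance of Minimum Cost Flow with Outliers (MCFO) consists of a finite directed graph $G=(V,E)$, a set $F\subseteq V$ of facilities with supplies $u_i\in\mathbb{N}$ ($i\in F$), a set $C\subseteq V$ of demand points with demands $w(j)\in\mathbb{N}$ ($j\in C$), nonnegative rational costs $d(u,v)$ for $(u,v)\in E$, and an integer $m\ge 0$. A feasible solution consists of nonnegative real flow values $\phi(e)$ ($e\in E$), served amounts $0\le s(j)\le w(j)$ ($j\in C$), and received amounts $0\le r(i)\le u_i$ ($i\in F$) (with $s=0$ outside $C$ and $r=0$ outside $F$), such that for every $v\in V$ $$\sum_{u:(u,v)\in E}\phi(u,v)+s(v)=\sum_{u:(v,u)\in E}\phi(v,u)+r(v),$$ and $\sum_{j\in C}s(j)\ge\sum_{j\in C}w(j)-m$. Its cost is $\sum_{e\in E}d(e)\phi(e)$. Statement. There is an algorithm that, for every instance of MCFO with all numbers written in binary, runs in time polynomial in the bit size of the instance and, if the instance has a feasible solution, returns an integral feasible solution (all $\phi(e)$, $s(j)$, $r(i)$ are integers) whose cost is minimum among all feasible, also fractional, solutions; if there is no feasible solution, it reports this. Here an algorithm is a program for a random access machine, and its running time is measured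 by the logarithmic cost criterion. -/

import Mathlib

/-! ### A random access machine with logarithmic cost

Programs are structured (`while`) programs over finitely many integer arrays; an integer variable is
an array of which only the cell `0` is used.  Every arithmetic operation and every memory access is
charged the bit lengths of all the numbers (operands, results and addresses) that it handles. -/

namespace RAM

/-- The memory: `s a i` is the natural number in the cell `i` of the array with name `a`. -/
abbrev State := ℕ → ℕ → ℕ

/-- Arithmetic expressions.  `get a e` reads the cell of the array `a` whose address is the value
of `e`. -/
inductive Expr where
  | const (k : ℕ)
  | get (a : ℕ) (e : Expr)
  | add (e₁ e₂ : Expr)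
  | sub (e₁ e₂ : Expr)
  | mul (e₁ e₂ : Expr)
  | div (e₁ e₂ : Expr)

namespace Expr

/-- The value of an expression (with truncated subtraction and floor division). -/
def val (s : State) : Expr → ℕ
  | const k => k
  | get a e => s a (e.val s)
  | add e₁ e₂ => e₁.val s + e₂.val s
  | sub e₁ e₂ => e₁.val s - e₂.val s
  | mul e₁ e₂ => e₁.val s * e₂.val s
  | div e₁ e₂ => e₁.val s / e₂.val s

/-- The logarithmic cost of evaluating an expression: each node costs one plus the bit length of
its value. -/
def time (s : State) : Expr → ℕ
  | const k => 1 + Nat.size k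
  | get a e => e.time s + (1 + Nat.size ((get a e).val s))
  | add e₁ e₂ => e₁.time s + e₂.time s + (1 + Nat.size ((add e₁ e₂).val s))
  | sub e₁ e₂ => e₁.time s + e₂.time s + (1 + Nat.size ((sub e₁ e₂).val s))
  | mul e₁ e₂ => e₁.time s + e₂.time s + (1 + Nat.size ((mul e₁ e₂).val s))
  | div e₁ e₂ => e₁.time s + e₂.time s + (1 + Nat.size ((div e₁ e₂).val s))

end Expr

/-- Programs.  `assign a i e` stores the value of `e` in the cell of the array `a` whose address is
the value of `i`.  A test `e` counts as true if its value is nonzero. -/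
inductive Program where
  | skip
  | assign (a : ℕ) (i e : Expr)
  | seq (c₁ c₂ : Program)
  | ite (e : Expr) (c₁ c₂ : Program)
  | loop (e : Expr) (c : Program)

/-- The memory after storing `x` in the cell `i` of the array `a`. -/
def State.set (s : State) (a i x : ℕ) : State :=
  Function.update s a (Function.update (s a) i x)

/-- `Exec c s t s'`: the program `c`, started with memory `s`, halts with memory `s'` after running
for time exactly `t`. -/
inductive Exec : Program → State → ℕ → State → Prop where
  | skip (s : State) : Exec .skip s 1 s
  | assign (s : State) (a : ℕ) (i e : Expr) :
      Exec (.assign a i e) s (i.time s + e.time s + 1) (s.set a (i.val s) (e.val s))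
  | seq {c₁ c₂ : Program} {s s₁ s₂ : State} {t₁ t₂ : ℕ} :
      Exec c₁ s t₁ s₁ → Exec c₂ s₁ t₂ s₂ → Exec (.seq c₁ c₂) s (t₁ + t₂ + 1) s₂
  | ite_true {e : Expr} {c₁ c₂ : Program} {s s' : State} {t : ℕ} :
      e.val s ≠ 0 → Exec c₁ s t s' → Exec (.ite e c₁ c₂) s (e.time s + t + 1) s'
  | ite_false {e : Expr} {c₁ c₂ : Program} {s s' : State} {t : ℕ} :
      e.val s = 0 → Exec c₂ s t s' → Exec (.ite e c₁ c₂) s (e.time s + t + 1) s'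
  | loop_done {e : Expr} {c : Program} {s : State} :
      e.val s = 0 → Exec (.loop e c) s (e.time s + 1) s
  | loop_step {e : Expr} {c : Program} {s s₁ s₂ : State} {t₁ t₂ : ℕ} :
      e.val s ≠ 0 → Exec c s t₁ s₁ → Exec (.loop e c) s₁ t₂ s₂ →
        Exec (.loop e c) s (e.time s + t₁ + t₂ + 1) s₂

/-- The initial memory: the array `0` holds the length of the input, followed by the input; every
other cell is `0`. -/
def initial (input : List ℕ) : State := fun a i =>
  if a = 0 then (input.length :: input).getD i 0 else 0

/-- The output: the array `1` holds the length of the output, followed by the output. -/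
def output (s : State) : List ℕ :=
  List.ofFn fun i : Fin (s 1 0) => s 1 (i + 1)

/-- The size, in bits, of a list of natural numbers written in binary. -/
def bitSize (l : List ℕ) : ℕ := (l.map fun x => Nat.size x + 1).sum

/-- A search problem, with instances `a : α` and answers `b : β a`, is solvable in polynomial time
if one program halts on every instance within a number of steps that is polynomial in the
bit size of the instance, and outputs a correct answer. -/
def SolvableInPolyTime {α : Type} {β : α → Type} (encodeInput : α → List ℕ)
    (encodeAnswer : (a : α) → β a → List ℕ) (Correct : (a : α) → β a → Prop) : Prop :=
  ∃ (c : Program) (p : Polynomial ℕ), ∀ a : α, ∃ (t : ℕ) (s : State),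
    Exec c (initial (encodeInput a)) t s ∧ t ≤ p.eval (bitSize (encodeInput a)) ∧
      ∃ b : β a, Correct a b ∧ output s = encodeAnswer a b

end RAM

/-! ### Minimum cost flow with outliers -/

/-- An instance of minimum cost flow with outliers, on the vertex set `Fin n`.  Only the supplies
of facilities, the demands of demand points, and the costs of edges are relevant. -/
structure MCFOInstance where
  n : ℕ
  /-- the directed edges -/
  E : Finset (Fin n × Fin n)
  /-- the facilities -/
  F : Finset (Fin n)
  /-- the demand points -/
  C : Finset (Fin n)
  supply : Fin n → ℕ
  demand : Fin n → ℕ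
  /-- the cost of an edge per unit of flow -/
  cost : Fin n × Fin n → ℚ≥0
  /-- the amount of demand that need not be routed -/
  m : ℕ

/-- A candidate solution on the vertex set `Fin n`, with amounts in `R`: `flow (u, v)` is sent along
the edge `(u, v)`, `served v` of the demand of `v` is sent out, and `received v` is absorbed by the
facility `v`. -/
structure MCFOFlow (n : ℕ) (R : Type) where
  flow : Fin n × Fin n → R
  served : Fin n → R
  received : Fin n → R

namespace MCFOFlow

/-- An integral candidate solution, viewed as a real one. -/
def toReal {n : ℕ} (S : MCFOFlow n ℕ) : MCFOFlow n ℝ where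
  flow e := (S.flow e : ℝ)
  served v := (S.served v : ℝ)
  received v := (S.received v : ℝ)

end MCFOFlow

namespace MCFOInstance

/-- Feasibility of a (possibly fractional) candidate solution. -/
structure IsFeasible (I : MCFOInstance) (S : MCFOFlow I.n ℝ) : Prop where
  flow_nonneg : ∀ e, 0 ≤ S.flow e
  flow_off : ∀ e, e ∉ I.E → S.flow e = 0
  served_nonneg : ∀ v, 0 ≤ S.served v
  served_le : ∀ v ∈ I.C, S.served v ≤ I.demand v
  served_off : ∀ v, v ∉ I.C → S.served v = 0
  received_nonneg : ∀ v, 0 ≤ S.received v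
  received_le : ∀ v ∈ I.F, S.received v ≤ I.supply v
  received_off : ∀ v, v ∉ I.F → S.received v = 0
  conservation : ∀ v, ∑ u, S.flow (u, v) + S.served v = ∑ u, S.flow (v, u) + S.received v
  outliers : ∑ v ∈ I.C, (I.demand v : ℝ) - I.m ≤ ∑ v ∈ I.C, S.served v

/-- The total cost of a candidate solution. -/
noncomputable def totalCost (I : MCFOInstance) (S : MCFOFlow I.n ℝ) : ℝ :=
  ∑ e ∈ I.E, (I.cost e : ℝ) * S.flow e

/-- `S` is a feasible solution of minimum cost among all, also fractional, feasible solutions. -/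
def IsOptimal (I : MCFOInstance) (S : MCFOFlow I.n ℝ) : Prop :=
  I.IsFeasible S ∧ ∀ T, I.IsFeasible T → I.totalCost S ≤ I.totalCost T

/-- The instance as a list of natural numbers: `n` and `m`, then for each vertex whether it is a
demand point and its demand, then for each vertex whether it is a facility and its supply, and
then for each pair of vertices whether it is an edge and the numerator and denominator of its
cost. -/
def encode (I : MCFOInstance) : List ℕ :=
  [I.n, I.m] ++
  (List.finRange I.n).flatMap (fun v => if v ∈ I.C then [1, I.demand v] else [0, 0]) ++
  (List.finRange I.n).flatMap (fun v => if v ∈ I.F then [1, I.supply v] else [0, 0]) ++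
  (List.finRange I.n).flatMap (fun u => (List.finRange I.n).flatMap fun v =>
    if (u, v) ∈ I.E then [1, (I.cost (u, v)).num, (I.cost (u, v)).den] else [0, 0, 0])

/-- The answer as a list of natural numbers: `0` if it is "infeasible", and otherwise `1`, followed
by all the amounts of the integral solution. -/
def encodeAnswer (I : MCFOInstance) : Option (MCFOFlow I.n ℕ) → List ℕ
  | none => [0]
  | some S =>
    [1] ++
    (List.finRange I.n).flatMap (fun u => (List.finRange I.n).map fun v => S.flow (u, v)) ++
    (List.finRange I.n).map S.served ++
    (List.finRange I.n).map S.received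

/-- The correct answers: "infeasible" if there is no (fractional) feasible solution, and otherwise
an integral optimal solution. -/
def IsCorrectAnswer (I : MCFOInstance) : Option (MCFOFlow I.n ℕ) → Prop
  | none => ∀ T, ¬ I.IsFeasible T
  | some S => I.IsOptimal S.toReal

end MCFOInstance

/-!
Outliers and unused supplies become flow in an uncapacitated transshipment network. The demand of
each vertex enters at a copy of the vertex, from where it is either served or sent to a node that
absorbs `m` units of outliers. The supply of each vertex is the demand of another copy, to be met by
what the vertex receives or from a node that emits the total slack. With the costs multiplied by a
common denominator and non-arcs made so expensive that an optimal flow avoids them whenever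
possible, this is transshipment on a complete digraph with integral data, and the instance is
infeasible exactly if the total demand is too large or the optimal flow uses a non-arc.

The scaling algorithm of Edmonds and Karp maintains an integral flow and a potential with
nonnegative residual reduced costs, which certify optimality even among fractional flows. In the
phase with scale `Δ = 2 ^ e`, units of size `Δ` are sent along shortest residual paths as long as
possible. All flow values are multiples of `Δ`, so a residual arc always has room for `Δ` units, and
on `N` nodes the phase needs at most `2 * N` augmentations.

For the running time, weakest preconditions bound only the number of iterations of each loop. This
suffices because every product in the program outside of addresses has a cell of the input array as
its left factor: an assignment then adds at most about as many bits to the largest number as an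
input cell has, so the running time is polynomial in the bound on the iterations and the bit size of
the input.
-/

/-! ### Uncapacitated transshipment on a complete digraph -/

namespace Transship

theorem le_sum_sum {ι κ R : Type*} [AddCommMonoid R] [PartialOrder R]
    [IsOrderedAddMonoid R] {s : Finset ι} {t : Finset κ} {g : ι → κ → R}
    (hg : ∀ a ∈ s, ∀ b ∈ t, 0 ≤ g a b) {i : ι} {j : κ} (hi : i ∈ s) (hj : j ∈ t) :
    g i j ≤ ∑ a ∈ s, ∑ b ∈ t, g a b :=
  (Finset.single_le_sum (hg i hi) hj).trans
    (Finset.single_le_sum (f := fun a => ∑ b ∈ t, g a b)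
      (fun a ha => Finset.sum_nonneg (hg a ha)) hi)

/-- Pigeonhole: the windows `(a + k * H, a + (k + 1) * H]` are disjoint, and there are more of them
than values of `f` above `a`. -/
theorem exists_gap {ι : Type*} {s : Finset ι} {i : ι} (hi : i ∈ s) {f : ι → ℕ} {a : ℕ}
    (ha : f i ≤ a) (H : ℕ) :
    ∃ k < s.card, ∀ j ∈ s, f j ≤ a + k * H ∨ a + (k + 1) * H < f j := by
  classical
  have hcard :
      ((s.erase i).image fun j => (f j - a - 1) / H).card < (Finset.range s.card).card := by
    rw [Finset.card_range]
    exact Finset.card_image_le.trans_lt (Finset.card_erase_lt_of_mem hi)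
  obtain ⟨k, hk, hk_image⟩ := Finset.exists_mem_notMem_of_card_lt_card hcard
  refine ⟨k, Finset.mem_range.1 hk, fun j hj => ?_⟩
  by_contra! hjk
  refine hk_image (Finset.mem_image.2 ⟨j, Finset.mem_erase.2 ⟨?_, hj⟩, ?_⟩)
  · rintro rfl
    omega
  · exact Nat.div_eq_of_lt_le (by omega) (by omega)

section Balanced

variable {N : ℕ}

/-- Flow conservation on the nodes `0, …, N - 1` for the flow `x` with the supplies `P` and the
demands `Q`. -/
def Balanced {R : Type*} [AddCommMonoid R] (N : ℕ) (x : ℕ → ℕ → R) (P Q : ℕ → R) : Prop :=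
  ∀ w < N, ∑ u ∈ Finset.range N, x u w + P w = ∑ u ∈ Finset.range N, x w u + Q w

theorem Balanced.natCast {R : Type*} [Semiring R] {x : ℕ → ℕ → ℕ} {P Q : ℕ → ℕ}
    (h : Balanced N x P Q) :
    Balanced N (fun u v => (x u v : R)) (fun w => (P w : R)) fun w => (Q w : R) := by
  intro w hw
  simpa using congrArg (Nat.cast (R := R)) (h w hw)

theorem Balanced.add {R : Type*} [AddCommMonoid R] {x y : ℕ → ℕ → R} {P P' Q Q' : ℕ → R}
    (hx : Balanced N x P Q) (hy : Balanced N y P' Q') :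
    Balanced N (x + y) (P + P') (Q + Q') := by
  intro w hw
  simp only [Pi.add_apply, Finset.sum_add_distrib]
  rw [add_add_add_comm, hx w hw, hy w hw, add_add_add_comm]

theorem Balanced.of_add {R : Type*} [AddCancelCommMonoid R] {x y : ℕ → ℕ → R} {P P' Q Q' : ℕ → R}
    (hxy : Balanced N (x + y) P Q) (hy : Balanced N y P' Q') :
    Balanced N x (P + Q') (Q + P') := by
  intro w hw
  have h₁ := hxy w hw
  have h₂ := hy w hw
  simp only [Pi.add_apply, Finset.sum_add_distrib] at h₁ ⊢
  set a := ∑ u ∈ Finset.range N, x u w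
  set b := ∑ u ∈ Finset.range N, x w u
  set a' := ∑ u ∈ Finset.range N, y u w
  set b' := ∑ u ∈ Finset.range N, y w u
  refine add_right_cancel (b := a' + b') ?_
  calc a + (P w + Q' w) + (a' + b') = (a + a' + P w) + (b' + Q' w) := by abel
    _ = (b + b' + Q w) + (a' + P' w) := by rw [h₁, h₂]
    _ = b + (Q w + P' w) + (a' + b') := by abel

theorem balanced_single {R : Type*} [AddCommMonoid R] {u v : ℕ} (hu : u < N) (hv : v < N) (d : R) :
    Balanced N (fun a b => if a = u ∧ b = v then d else 0) (Pi.single u d) (Pi.single v d) := by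
  intro w _
  have h_in : ∑ a ∈ Finset.range N, (if a = u ∧ w = v then d else 0) =
      (Pi.single v d : ℕ → R) w := by
    by_cases h : w = v <;> simp [h, hu]
  have h_out : ∑ b ∈ Finset.range N, (if w = u ∧ b = v then d else 0) =
      (Pi.single u d : ℕ → R) w := by
    by_cases h : w = u <;> simp [h, hv]
  rw [h_in, h_out, add_comm]

theorem Balanced.sum_mul_sub {R : Type*} [CommRing R] {z : ℕ → ℕ → R} {P Q : ℕ → R}
    (h : Balanced N z P Q) (f : ℕ → R) :
    ∑ u ∈ Finset.range N, ∑ v ∈ Finset.range N, z u v * (f u - f v) =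
      ∑ w ∈ Finset.range N, f w * (P w - Q w) := by
  have hw : ∀ w ∈ Finset.range N, f w * (P w - Q w) =
      ∑ v ∈ Finset.range N, z w v * f w - ∑ u ∈ Finset.range N, z u w * f w := by
    intro w hw
    rw [← Finset.sum_mul, ← Finset.sum_mul]
    linear_combination f w * h w (Finset.mem_range.1 hw)
  rw [Finset.sum_congr rfl hw, Finset.sum_sub_distrib,
    Finset.sum_comm (f := fun w u => z u w * f w)]
  simp only [mul_sub, Finset.sum_sub_distrib]

theorem Balanced.sum_mul_sub_eq {R : Type*} [CommRing R] {x y : ℕ → ℕ → R} {P Q : ℕ → R}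
    (hx : Balanced N x P Q) (hy : Balanced N y P Q) (f : ℕ → R) :
    ∑ u ∈ Finset.range N, ∑ v ∈ Finset.range N, x u v * (f u - f v) =
      ∑ u ∈ Finset.range N, ∑ v ∈ Finset.range N, y u v * (f u - f v) :=
  (hx.sum_mul_sub f).trans (hy.sum_mul_sub f).symm

end Balanced

section Certificate

variable {N : ℕ} {c x : ℕ → ℕ → ℕ} {π π' : ℕ → ℕ}

/-- The node potential `π` is feasible for the costs `c` and satisfies complementary slackness with
the flow `x`; this certifies that `x` has minimum cost. -/
structure IsCertificate (N : ℕ) (c x : ℕ → ℕ → ℕ) (π : ℕ → ℕ) : Prop where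
  le : ∀ u < N, ∀ v < N, π v ≤ π u + c u v
  tight : ∀ u < N, ∀ v < N, x u v ≠ 0 → π u + c u v ≤ π v

theorem IsCertificate.congr (h : IsCertificate N c x π) (hπ : ∀ v < N, π' v = π v) :
    IsCertificate N c x π' where
  le u hu v hv := by rw [hπ u hu, hπ v hv]; exact h.le u hu v hv
  tight u hu v hv := by rw [hπ u hu, hπ v hv]; exact h.tight u hu v hv

variable {R : Type*} [CommRing R] [LinearOrder R] [IsStrictOrderedRing R]

theorem IsCertificate.sum_mul_le {P Q : ℕ → R} {y : ℕ → ℕ → R} (h : IsCertificate N c x π)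
    (hx : Balanced N (fun u v => (x u v : R)) P Q) (hy : Balanced N y P Q)
    (hy₀ : ∀ u < N, ∀ v < N, 0 ≤ y u v) :
    ∑ u ∈ Finset.range N, ∑ v ∈ Finset.range N, (c u v : R) * x u v ≤
      ∑ u ∈ Finset.range N, ∑ v ∈ Finset.range N, (c u v : R) * y u v := by
  have hsum : ∑ u ∈ Finset.range N, ∑ v ∈ Finset.range N,
        ((c u v : R) * x u v + x u v * (π u - π v)) ≤
      ∑ u ∈ Finset.range N, ∑ v ∈ Finset.range N,
        ((c u v : R) * y u v + y u v * (π u - π v)) := by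
    refine Finset.sum_le_sum fun u hu => Finset.sum_le_sum fun v hv => ?_
    rw [Finset.mem_range] at hu hv
    have hle : (π v : R) ≤ π u + c u v := by exact_mod_cast h.le u hu v hv
    have hx_zero : (c u v : R) * x u v + x u v * (π u - π v) = 0 := by
      by_cases hxuv : x u v = 0
      · simp [hxuv]
      · have : (π u : R) + c u v = π v := by
          exact_mod_cast le_antisymm (h.tight u hu v hv hxuv) (h.le u hu v hv)
        linear_combination (x u v : R) * this
    rw [hx_zero]
    nlinarith [hy₀ u hu v hv]
  simp only [Finset.sum_add_distrib] at hsum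
  rw [hx.sum_mul_sub_eq hy fun w => (π w : R)] at hsum
  exact le_of_add_le_add_right hsum

/-- The nodes of potential at most `θ` form a cut. No cheap arc leaves it, because the potential
would have to jump over the gap, and an optimal flow never enters it. -/
theorem IsCertificate.flow_eq_zero_of_gap {P Q : ℕ → R} {y : ℕ → ℕ → R} {H θ : ℕ}
    (h : IsCertificate N c x π) (hx : Balanced N (fun u v => (x u v : R)) P Q)
    (hy : Balanced N y P Q) (hy₀ : ∀ u < N, ∀ v < N, 0 ≤ y u v)
    (hyH : ∀ u < N, ∀ v < N, y u v ≠ 0 → c u v ≤ H)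
    (hgap : ∀ v < N, π v ≤ θ ∨ θ + H < π v) {u v : ℕ} (hu : u < N) (hv : v < N)
    (hπu : π u ≤ θ) (hπv : θ < π v) : x u v = 0 := by
  let f : ℕ → R := fun w => if π w ≤ θ then 1 else 0
  have hx_nonneg : ∀ a ∈ Finset.range N, ∀ b ∈ Finset.range N,
      (0 : R) ≤ x a b * (f a - f b) := by
    intro a ha b hb
    have := h.tight a (Finset.mem_range.1 ha) b (Finset.mem_range.1 hb)
    by_cases hab : x a b = 0
    · simp [hab]
    · have hfab : π b ≤ θ → π a ≤ θ := by have := this hab; omega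
      refine mul_nonneg (Nat.cast_nonneg _) ?_
      simp only [f]
      split_ifs <;> simp_all
  have hy_nonpos : ∑ a ∈ Finset.range N, ∑ b ∈ Finset.range N, y a b * (f a - f b) ≤ 0 := by
    refine Finset.sum_nonpos fun a ha => Finset.sum_nonpos fun b hb => ?_
    rw [Finset.mem_range] at ha hb
    by_cases hab : y a b = 0
    · simp [hab]
    · have hfab : π a ≤ θ → π b ≤ θ := by
        have := hyH a ha b hb hab
        have := h.le a ha b hb
        have := hgap b hb
        omega
      refine mul_nonpos_of_nonneg_of_nonpos (hy₀ a ha b hb) ?_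
      simp only [f]
      split_ifs <;> simp_all
  have hx_le : (x u v : R) * (f u - f v) ≤ 0 := by
    rw [← hx.sum_mul_sub_eq hy f] at hy_nonpos
    exact (le_sum_sum hx_nonneg (Finset.mem_range.2 hu) (Finset.mem_range.2 hv)).trans hy_nonpos
  have hfu : f u = 1 := if_pos hπu
  have hfv : f v = 0 := if_neg hπv.not_ge
  rw [hfu, hfv, sub_zero, mul_one] at hx_le
  exact_mod_cast le_antisymm hx_le (Nat.cast_nonneg _)

theorem IsCertificate.flow_eq_zero {P Q : ℕ → R} {y : ℕ → ℕ → R} {H : ℕ}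
    (h : IsCertificate N c x π) (hx : Balanced N (fun u v => (x u v : R)) P Q)
    (hy : Balanced N y P Q) (hy₀ : ∀ u < N, ∀ v < N, 0 ≤ y u v)
    (hyH : ∀ u < N, ∀ v < N, y u v ≠ 0 → c u v ≤ H) {u v : ℕ} (hu : u < N) (hv : v < N)
    (huv : N * H < c u v) : x u v = 0 := by
  by_contra hxuv
  obtain ⟨k, hkN, hk⟩ := exists_gap (Finset.mem_range.2 hu) (le_refl (π u)) H
  rw [Finset.card_range] at hkN
  have hkH : k * H ≤ N * H := Nat.mul_le_mul_right _ hkN.le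
  have hπ := h.tight u hu v hv hxuv
  refine hxuv (h.flow_eq_zero_of_gap hx hy hy₀ hyH (θ := π u + k * H) (fun w hw => ?_) hu hv
    (Nat.le_add_right _ _) (by omega))
  simpa only [add_one_mul, add_assoc] using hk w (Finset.mem_range.2 hw)

end Certificate

section Residual

variable {N : ℕ} {c x : ℕ → ℕ → ℕ} {π π' A par rk P Q : ℕ → ℕ} {s : ℕ}

/-- The cost of the pair `(u, v)` in the residual network of the flow `x`, reduced by the potential
`π`. A positive flow from `v` to `u` can be cancelled at reduced cost zero, by complementary
slackness. -/
def reducedCost (c x : ℕ → ℕ → ℕ) (π : ℕ → ℕ) (u v : ℕ) : ℕ :=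
  if x v u ≠ 0 then 0 else c u v + π u - π v

/-- The residual network has an arc from `u` to `v` of reduced cost zero. -/
def Tight (c x : ℕ → ℕ → ℕ) (π : ℕ → ℕ) (u v : ℕ) : Prop :=
  x v u ≠ 0 ∨ π v = π u + c u v

/-- The flow after sending `d` units from `u` to `v` in the residual network. -/
def push (x : ℕ → ℕ → ℕ) (d u v : ℕ) : ℕ → ℕ → ℕ := fun a b =>
  if x v u ≠ 0 then x a b - (if a = v ∧ b = u then d else 0)
  else x a b + (if a = u ∧ b = v then d else 0)

theorem IsCertificate.raise (h : IsCertificate N c x π) {δ : ℕ}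
    (hδ : ∀ u < N, ∀ v < N, A u ≠ 0 → A v = 0 → δ ≤ reducedCost c x π u v) :
    IsCertificate N c x fun w => if A w = 0 then π w + δ else π w := by
  constructor
  · intro u hu v hv
    have hle := h.le u hu v hv
    have hδuv := hδ u hu v hv
    unfold reducedCost at hδuv
    split_ifs at hδuv ⊢ <;> simp_all <;> omega
  · intro u hu v hv hx
    have htight := h.tight u hu v hv hx
    have hle := h.le u hu v hv
    have hδuv := hδ u hu v hv
    have hδvu := hδ v hv u hu
    unfold reducedCost at hδuv hδvu
    split_ifs at hδuv hδvu ⊢ <;> simp_all <;> omega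

theorem IsCertificate.push (h : IsCertificate N c x π) {u v : ℕ} (ht : Tight c x π u v) (d : ℕ) :
    IsCertificate N c (push x d u v) π := by
  refine ⟨h.le, fun a ha b hb hx => ?_⟩
  unfold Transship.push at hx
  split_ifs at hx with hvu hab hab
  · exact h.tight a ha b hb (by omega)
  · exact h.tight a ha b hb (by omega)
  · obtain ⟨rfl, rfl⟩ := hab
    exact (ht.resolve_left hvu).ge
  · exact h.tight a ha b hb hx

theorem dvd_push {d u v : ℕ} (h : ∀ a b, d ∣ x a b) (a b : ℕ) : d ∣ push x d u v a b := by
  unfold push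
  split_ifs
  · exact Nat.dvd_sub (h a b) dvd_rfl
  · exact h a b
  · exact (h a b).add dvd_rfl
  · exact h a b

theorem Balanced.push {d u v : ℕ} (h : Balanced N x P Q) (hu : u < N) (hv : v < N)
    (hd : d ∣ x v u) :
    Balanced N (push x d u v) (P + Pi.single u d) (Q + Pi.single v d) := by
  by_cases hvu : x v u ≠ 0
  · have h_add : Transship.push x d u v + (fun a b => if a = v ∧ b = u then d else 0) = x := by
      funext a b
      have := Nat.le_of_dvd (Nat.pos_of_ne_zero hvu) hd
      simp only [Transship.push, if_pos hvu, Pi.add_apply]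
      split_ifs with hab
      · obtain ⟨rfl, rfl⟩ := hab
        omega
      · rfl
    exact Balanced.of_add (by rwa [h_add]) (balanced_single hv hu d)
  · have h_add : Transship.push x d u v = x + fun a b => if a = u ∧ b = v then d else 0 := by
      funext a b
      simp only [Transship.push, if_neg hvu, Pi.add_apply]
    rw [h_add]
    exact h.add (balanced_single hu hv d)

/-- The number of nodes that are not marked in `A`. -/
def unmarkedCount (N : ℕ) (A : ℕ → ℕ) : ℕ := ((Finset.range N).filter fun v => A v = 0).card

theorem unmarkedCount_le (N : ℕ) (A : ℕ → ℕ) : unmarkedCount N A ≤ N :=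
  (Finset.card_filter_le _ _).trans_eq (Finset.card_range N)

theorem unmarkedCount_update {v : ℕ} (hv : v < N) (hA : A v = 0) :
    unmarkedCount N (Function.update A v 1) + 1 = unmarkedCount N A := by
  unfold unmarkedCount
  rw [← Finset.card_erase_add_one (a := v) (s := (Finset.range N).filter fun v => A v = 0)
    (by simp [hv, hA])]
  congr 2
  ext a
  by_cases ha : a = v <;> simp [ha, Function.update_apply]

/-- The parents `par` form a tree with root `s` on the nodes marked in `A`, made of residual arcs of
reduced cost zero. The rank `rk` increases along its arcs, which bounds the length of its paths. -/
structure TightTree (N : ℕ) (c x : ℕ → ℕ → ℕ) (π A par rk : ℕ → ℕ) (s : ℕ) : Prop where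
  root : A s ≠ 0
  par_lt : ∀ v < N, A v ≠ 0 → v ≠ s → par v < N
  par_mem : ∀ v < N, A v ≠ 0 → v ≠ s → A (par v) ≠ 0
  rk_lt : ∀ v < N, A v ≠ 0 → v ≠ s → rk (par v) < rk v
  tight : ∀ v < N, A v ≠ 0 → v ≠ s → Tight c x π (par v) v
  rk_le : ∀ v < N, A v ≠ 0 → rk v + unmarkedCount N A ≤ N

theorem TightTree.congr (h : TightTree N c x π A par rk s) (hπ : ∀ v < N, π' v = π v) :
    TightTree N c x π' A par rk s where
  root := h.root
  par_lt := h.par_lt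
  par_mem := h.par_mem
  rk_lt := h.rk_lt
  tight v hv hA hs := by
    unfold Tight
    rw [hπ v hv, hπ _ (h.par_lt v hv hA hs)]
    exact h.tight v hv hA hs
  rk_le := h.rk_le

theorem tightTree_of_forall_eq_root (hs : A s ≠ 0) (hA : ∀ v < N, A v ≠ 0 → v = s) :
    TightTree N c x π A par (fun _ => 0) s where
  root := hs
  par_lt v hv hv' hne := absurd (hA v hv hv') hne
  par_mem v hv hv' hne := absurd (hA v hv hv') hne
  rk_lt v hv hv' hne := absurd (hA v hv hv') hne
  tight v hv hv' hne := absurd (hA v hv hv') hne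
  rk_le _ _ _ := by simpa using unmarkedCount_le N A

theorem tight_raise {u v : ℕ} (hAu : A u ≠ 0) (hAv : A v = 0) (h : π v ≤ π u + c u v) :
    Tight c x (fun w => if A w = 0 then π w + reducedCost c x π u v else π w) u v := by
  unfold Tight reducedCost
  by_cases hx : x v u = 0
  · refine .inr ?_
    simp only [hAu, hAv, hx, if_true, if_false, ne_eq, not_true_eq_false]
    omega
  · exact .inl hx

theorem TightTree.extend (h : TightTree N c x π A par rk s) (hc : IsCertificate N c x π) {u v : ℕ}
    (hu : u < N) (hv : v < N) (hAu : A u ≠ 0) (hAv : A v = 0) :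
    TightTree N c x (fun w => if A w = 0 then π w + reducedCost c x π u v else π w)
      (Function.update A v 1) (Function.update par v u) (Function.update rk v (rk u + 1)) s := by
  have huv : u ≠ v := by rintro rfl; exact hAu hAv
  have hpar : ∀ a < N, A a ≠ 0 → a ≠ s → par a ≠ v := by
    rintro a ha hAa has rfl
    exact h.par_mem a ha hAa has hAv
  have hcount := unmarkedCount_update hv hAv
  refine ⟨?_, fun a ha hAa has => ?_, fun a ha hAa has => ?_, fun a ha hAa has => ?_,
    fun a ha hAa has => ?_, fun a ha hAa => ?_⟩
  · by_cases hsv : s = v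
    · simp [hsv]
    · simpa [hsv] using h.root
  all_goals rcases eq_or_ne a v with rfl | hav
  any_goals simp only [Function.update_of_ne hav] at hAa
  · simpa using hu
  · simpa [hav] using h.par_lt a ha hAa has
  · simpa [huv] using hAu
  · simpa [hav, hpar a ha hAa has] using h.par_mem a ha hAa has
  · simp [huv]
  · simpa [hav, hpar a ha hAa has] using h.rk_lt a ha hAa has
  · simpa using tight_raise hAu hAv (hc.le u hu a hv)
  · simpa [Tight, hav, hAa, h.par_mem a ha hAa has] using h.tight a ha hAa has
  · have := h.rk_le u hu hAu
    simp only [Function.update_self]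
    omega
  · have := h.rk_le a ha hAa
    simp only [Function.update_of_ne hav]
    omega

theorem TightTree.tight_push {y : ℕ → ℕ → ℕ} {v w : ℕ} (h : TightTree N c x π A par rk s) (d : ℕ)
    (hv : v < N) (hAv : A v ≠ 0) (hvs : v ≠ s) (hw : w < N) (hAw : A w ≠ 0) (hws : w ≠ s)
    (hrk : rk w ≤ rk (par v)) (ht : Tight c y π (par w) w) :
    Tight c (push y d (par v) v) π (par w) w := by
  have hrkv := h.rk_lt v hv hAv hvs
  have hrkw := h.rk_lt w hw hAw hws
  have hwv : w ≠ v := by rintro rfl; omega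
  have hwp : ¬(w = par v ∧ par w = v) := by rintro ⟨_, hp⟩; rw [hp] at hrkw; omega
  have hy : push y d (par v) v w (par w) = y w (par w) := by
    simp [push, hwv, hwp]
  unfold Tight at ht ⊢
  rwa [hy]

/-- The situation while `d` units are sent along the path of the tree from the root to the node `t`,
going backwards from `t`: the units have been sent from `v` to `t`, and the part of the tree that is
still needed consists of arcs of reduced cost zero in the current flow `x`. -/
structure IsPartialAugmentation (N : ℕ) (c : ℕ → ℕ → ℕ) (π A par rk P Q : ℕ → ℕ) (s t d : ℕ)
    (x : ℕ → ℕ → ℕ) (v : ℕ) : Prop where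
  lt : v < N
  marked : A v ≠ 0
  certificate : IsCertificate N c x π
  dvd : ∀ a b, d ∣ x a b
  tight : ∀ w < N, A w ≠ 0 → w ≠ s → rk w ≤ rk v → Tight c x π (par w) w
  balanced : Balanced N x (P + Pi.single v d) (Q + Pi.single t d)

theorem TightTree.isPartialAugmentation {t d : ℕ} (h : TightTree N c x π A par rk s)
    (hc : IsCertificate N c x π) (ht : t < N) (hAt : A t ≠ 0) (hd : ∀ a b, d ∣ x a b)
    (hb : Balanced N x P Q) : IsPartialAugmentation N c π A par rk P Q s t d x t where
  lt := ht
  marked := hAt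
  certificate := hc
  dvd := hd
  tight w hw hAw hws _ := h.tight w hw hAw hws
  balanced w hw := by
    simp only [Pi.add_apply, ← add_assoc]
    rw [hb w hw]

theorem IsPartialAugmentation.step {y : ℕ → ℕ → ℕ} {t d v : ℕ}
    (h : IsPartialAugmentation N c π A par rk P Q s t d y v)
    (hT : TightTree N c x π A par rk s) (hvs : v ≠ s) :
    IsPartialAugmentation N c π A par rk P Q s t d (push y d (par v) v) (par v) where
  lt := hT.par_lt v h.lt h.marked hvs
  marked := hT.par_mem v h.lt h.marked hvs
  certificate := h.certificate.push (h.tight v h.lt h.marked hvs le_rfl) d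
  dvd := dvd_push h.dvd
  tight w hw hAw hws hrk :=
    have hrkv := hT.rk_lt v h.lt h.marked hvs
    hT.tight_push d h.lt h.marked hvs hw hAw hws hrk (h.tight w hw hAw hws (by omega))
  balanced w hw := by
    have := h.balanced.push (hT.par_lt v h.lt h.marked hvs) h.lt (h.dvd v (par v)) w hw
    simp only [Pi.add_apply] at this ⊢
    omega

end Residual

end Transship

namespace MCFOInstance

/-! ### Reduction to transshipment -/

open Transship

section Sums

variable {α : Type*} [AddCommMonoid α] {n : ℕ} {z : ℕ → ℕ → α} {P Q : ℕ → α}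

/-- The pairs of nodes that may be joined by an arc.  The nodes are the vertices, a copy `n + v` and
a copy `2 * n + v` of each vertex `v` for demand and supply, a node `3 * n` that absorbs the
outliers, and a node `3 * n + 1` from which the unused supply comes. -/
def IsArcShape (n u v : ℕ) : Prop :=
  u < n ∧ v < n ∨ n ≤ u ∧ u < 2 * n ∧ (v + n = u ∨ v = 3 * n) ∨ u < n ∧ v = 2 * n + u ∨
    u = 3 * n + 1 ∧ 2 * n ≤ v ∧ v ≤ 3 * n

theorem forall_node {p : ℕ → Prop} : (∀ w < 3 * n + 2, p w) ↔ (∀ i : Fin n, p i) ∧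
    (∀ i : Fin n, p (n + i)) ∧ (∀ i : Fin n, p (2 * n + i)) ∧ p (3 * n) ∧ p (3 * n + 1) := by
  refine ⟨fun h => ⟨fun i => h _ (by omega), fun i => h _ (by omega), fun i => h _ (by omega),
    h _ (by omega), h _ (by omega)⟩, fun ⟨h₁, h₂, h₃, h₄, h₅⟩ w hw => ?_⟩
  obtain hw₁ | ⟨i, hi, rfl⟩ | ⟨i, hi, rfl⟩ | rfl | rfl : w < n ∨ (∃ i < n, w = n + i) ∨
      (∃ i < n, w = 2 * n + i) ∨ w = 3 * n ∨ w = 3 * n + 1 := by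
    by_cases h₁ : w < n
    · exact .inl h₁
    by_cases h₂ : w < 2 * n
    · exact .inr (.inl ⟨w - n, by omega, by omega⟩)
    by_cases h₃ : w < 3 * n
    · exact .inr (.inr (.inl ⟨w - 2 * n, by omega, by omega⟩))
    omega
  exacts [h₁ ⟨w, hw₁⟩, h₂ ⟨i, hi⟩, h₃ ⟨i, hi⟩, h₄, h₅]

theorem sum_node_eq {f : ℕ → α} (s : Finset ℕ) (hs : ∀ u ∈ s, u < 3 * n + 2)
    (hf : ∀ u < 3 * n + 2, u ∉ s → f u = 0) :
    ∑ u ∈ Finset.range (3 * n + 2), f u = ∑ u ∈ s, f u :=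
  (Finset.sum_subset (fun u hu => Finset.mem_range.2 (hs u hu))
    fun u hu => hf u (Finset.mem_range.1 hu)).symm

variable (hz : ∀ u < 3 * n + 2, ∀ v < 3 * n + 2, ¬IsArcShape n u v → z u v = 0)

include hz

theorem sum_in_vertex (i : Fin n) : ∑ u ∈ Finset.range (3 * n + 2), z u i =
    ∑ j : Fin n, z j i + z (n + i) i := by
  rw [sum_node_eq (insert (n + i : ℕ) (Finset.range n)), Finset.sum_insert (by simp), add_comm,
    Fin.sum_univ_eq_sum_range fun j => z j i]
  · intro u; simp only [Finset.mem_insert, Finset.mem_range]; omega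
  · intro u hu hu'
    simp only [Finset.mem_insert, Finset.mem_range] at hu'
    exact hz u hu i (by omega) (by unfold IsArcShape; omega)

theorem sum_out_vertex (i : Fin n) : ∑ v ∈ Finset.range (3 * n + 2), z i v =
    ∑ j : Fin n, z i j + z i (2 * n + i) := by
  rw [sum_node_eq (insert (2 * n + i : ℕ) (Finset.range n)),
    Finset.sum_insert (by rw [Finset.mem_range]; omega), add_comm,
    Fin.sum_univ_eq_sum_range fun j => z i j]
  · intro u; simp only [Finset.mem_insert, Finset.mem_range]; omega
  · intro v hv hv'
    simp only [Finset.mem_insert, Finset.mem_range] at hv'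
    exact hz i (by omega) v hv (by unfold IsArcShape; omega)

theorem sum_in_demand (i : Fin n) : ∑ u ∈ Finset.range (3 * n + 2), z u (n + i) = 0 :=
  Finset.sum_eq_zero fun u hu =>
    hz u (Finset.mem_range.1 hu) _ (by omega) (by unfold IsArcShape; omega)

theorem sum_out_demand (i : Fin n) : ∑ v ∈ Finset.range (3 * n + 2), z (n + i) v =
    z (n + i) i + z (n + i) (3 * n) := by
  rw [sum_node_eq {(i : ℕ), 3 * n}, Finset.sum_pair (by omega)]
  · intro v; simp only [Finset.mem_insert, Finset.mem_singleton]; omega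
  · intro v hv hv'
    simp only [Finset.mem_insert, Finset.mem_singleton] at hv'
    exact hz _ (by omega) v hv (by unfold IsArcShape; omega)

theorem sum_in_supply (i : Fin n) : ∑ u ∈ Finset.range (3 * n + 2), z u (2 * n + i) =
    z i (2 * n + i) + z (3 * n + 1) (2 * n + i) := by
  rw [sum_node_eq {(i : ℕ), 3 * n + 1}, Finset.sum_pair (by omega)]
  · intro u; simp only [Finset.mem_insert, Finset.mem_singleton]; omega
  · intro u hu hu'
    simp only [Finset.mem_insert, Finset.mem_singleton] at hu'
    exact hz u hu _ (by omega) (by unfold IsArcShape; omega)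

theorem sum_out_supply (i : Fin n) : ∑ v ∈ Finset.range (3 * n + 2), z (2 * n + i) v = 0 :=
  Finset.sum_eq_zero fun v hv =>
    hz _ (by omega) v (Finset.mem_range.1 hv) (by unfold IsArcShape; omega)

theorem sum_in_outliers : ∑ u ∈ Finset.range (3 * n + 2), z u (3 * n) =
    ∑ i : Fin n, z (n + i) (3 * n) + z (3 * n + 1) (3 * n) := by
  rw [sum_node_eq (insert (3 * n + 1) (Finset.Ico n (n + n))),
    Finset.sum_insert (by rw [Finset.mem_Ico]; omega), add_comm, Finset.sum_Ico_eq_sum_range,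
    Nat.add_sub_cancel, Fin.sum_univ_eq_sum_range fun i => z (n + i) (3 * n)]
  · intro u; simp only [Finset.mem_insert, Finset.mem_Ico]; omega
  · intro u hu hu'
    simp only [Finset.mem_insert, Finset.mem_Ico] at hu'
    exact hz u hu _ (by omega) (by unfold IsArcShape; omega)

theorem sum_out_outliers : ∑ v ∈ Finset.range (3 * n + 2), z (3 * n) v = 0 :=
  Finset.sum_eq_zero fun v hv =>
    hz _ (by omega) v (Finset.mem_range.1 hv) (by unfold IsArcShape; omega)

theorem sum_in_unused : ∑ u ∈ Finset.range (3 * n + 2), z u (3 * n + 1) = 0 :=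
  Finset.sum_eq_zero fun u hu =>
    hz u (Finset.mem_range.1 hu) _ (by omega) (by unfold IsArcShape; omega)

theorem sum_out_unused : ∑ v ∈ Finset.range (3 * n + 2), z (3 * n + 1) v =
    ∑ i : Fin n, z (3 * n + 1) (2 * n + i) + z (3 * n + 1) (3 * n) := by
  rw [sum_node_eq (insert (3 * n) (Finset.Ico (2 * n) (2 * n + n))),
    Finset.sum_insert (by rw [Finset.mem_Ico]; omega), add_comm, Finset.sum_Ico_eq_sum_range,
    Nat.add_sub_cancel_left, Fin.sum_univ_eq_sum_range fun i => z (3 * n + 1) (2 * n + i)]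
  · intro v; simp only [Finset.mem_insert, Finset.mem_Ico]; omega
  · intro v hv hv'
    simp only [Finset.mem_insert, Finset.mem_Ico] at hv'
    exact hz _ (by omega) v hv (by unfold IsArcShape; omega)

theorem balanced_iff : Transship.Balanced (3 * n + 2) z P Q ↔
    (∀ i : Fin n, ∑ j : Fin n, z j i + z (n + i) i + P i =
      ∑ j : Fin n, z i j + z i (2 * n + i) + Q i) ∧
    (∀ i : Fin n, P (n + i) = z (n + i) i + z (n + i) (3 * n) + Q (n + i)) ∧
    (∀ i : Fin n, z i (2 * n + i) + z (3 * n + 1) (2 * n + i) + P (2 * n + i) = Q (2 * n + i)) ∧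
    ∑ i : Fin n, z (n + i) (3 * n) + z (3 * n + 1) (3 * n) + P (3 * n) = Q (3 * n) ∧
    P (3 * n + 1) =
      ∑ i : Fin n, z (3 * n + 1) (2 * n + i) + z (3 * n + 1) (3 * n) + Q (3 * n + 1) := by
  simp only [Transship.Balanced, forall_node, sum_in_vertex hz, sum_out_vertex hz, sum_in_demand hz,
    sum_out_demand hz, sum_in_supply hz, sum_out_supply hz, sum_in_outliers hz,
    sum_out_outliers hz, sum_in_unused hz, sum_out_unused hz, zero_add]

end Sums

variable {I : MCFOInstance} {T : MCFOFlow I.n ℝ}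

/-- The demand of the vertex with number `k`, zero outside of the demand points. -/
def demandAt (I : MCFOInstance) (k : ℕ) : ℕ :=
  if h : k < I.n then (if ⟨k, h⟩ ∈ I.C then I.demand ⟨k, h⟩ else 0) else 0

/-- The supply of the vertex with number `k`, zero outside of the facilities. -/
def supplyAt (I : MCFOInstance) (k : ℕ) : ℕ :=
  if h : k < I.n then (if ⟨k, h⟩ ∈ I.F then I.supply ⟨k, h⟩ else 0) else 0

/-- The total demand. -/
def totalDemand (I : MCFOInstance) : ℕ := ∑ k ∈ Finset.range I.n, I.demandAt k

/-- The total supply. -/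
def totalSupply (I : MCFOInstance) : ℕ := ∑ k ∈ Finset.range I.n, I.supplyAt k

theorem demandAt_coe (i : Fin I.n) : I.demandAt i = if i ∈ I.C then I.demand i else 0 := by
  simp [demandAt]

theorem supplyAt_coe (i : Fin I.n) : I.supplyAt i = if i ∈ I.F then I.supply i else 0 := by
  simp [supplyAt]

theorem totalDemand_eq : I.totalDemand = ∑ i : Fin I.n, I.demandAt i :=
  (Fin.sum_univ_eq_sum_range _ _).symm

theorem totalSupply_eq : I.totalSupply = ∑ i : Fin I.n, I.supplyAt i :=
  (Fin.sum_univ_eq_sum_range _ _).symm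

theorem sum_demand_eq_totalDemand : ∑ v ∈ I.C, (I.demand v : ℝ) = I.totalDemand := by
  simp [totalDemand_eq, demandAt_coe, Finset.sum_ite_mem]

section IsFeasible

variable (h : I.IsFeasible T)

include h

theorem IsFeasible.served_le_demandAt (i : Fin I.n) : T.served i ≤ I.demandAt i := by
  rw [demandAt_coe]
  split_ifs with hi
  · exact h.served_le i hi
  · simp [h.served_off i hi]

theorem IsFeasible.received_le_supplyAt (i : Fin I.n) : T.received i ≤ I.supplyAt i := by
  rw [supplyAt_coe]
  split_ifs with hi
  · exact h.received_le i hi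
  · simp [h.received_off i hi]

theorem IsFeasible.sum_served_eq : ∑ i, T.served i = ∑ i, T.received i := by
  have h_sum := Fintype.sum_congr _ _ h.conservation
  rw [Finset.sum_add_distrib, Finset.sum_add_distrib, Finset.sum_comm] at h_sum
  exact add_left_cancel h_sum

theorem IsFeasible.totalDemand_le_sum_served : (I.totalDemand : ℝ) ≤ I.m + ∑ i, T.served i := by
  have h_out := h.outliers
  rw [sum_demand_eq_totalDemand, Finset.sum_subset (Finset.subset_univ I.C)
    (fun i _ hi => h.served_off i hi)] at h_out
  linarith

theorem IsFeasible.totalDemand_le : I.totalDemand ≤ I.totalSupply + I.m := by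
  have h_served := h.totalDemand_le_sum_served
  have h_received : ∑ i, T.received i ≤ I.totalSupply := by
    rw [totalSupply_eq, Nat.cast_sum]
    exact Finset.sum_le_sum fun i _ => h.received_le_supplyAt i
  have : (I.totalDemand : ℝ) ≤ I.totalSupply + I.m := by linarith [h.sum_served_eq]
  exact_mod_cast this

end IsFeasible

/-- The arcs of the network. -/
def IsArc (I : MCFOInstance) (u v : ℕ) : Prop :=
  IsArcShape I.n u v ∧ ∀ (hu : u < I.n) (hv : v < I.n), (⟨u, hu⟩, ⟨v, hv⟩) ∈ I.E

/-- The supplies in the network. -/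
def netSupply (I : MCFOInstance) (w : ℕ) : ℕ :=
  if I.n ≤ w ∧ w < 2 * I.n then I.demandAt (w - I.n)
  else if w = 3 * I.n + 1 then I.totalSupply + I.m - I.totalDemand else 0

/-- The demands in the network. -/
def netDemand (I : MCFOInstance) (w : ℕ) : ℕ :=
  if 2 * I.n ≤ w ∧ w < 3 * I.n then I.supplyAt (w - 2 * I.n) else if w = 3 * I.n then I.m else 0

section NetBalance

theorem netSupply_vertex (i : Fin I.n) : I.netSupply i = 0 := by
  rw [netSupply, if_neg (by omega), if_neg (by omega)]

theorem netSupply_demand (i : Fin I.n) : I.netSupply (I.n + i) = I.demandAt i := by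
  rw [netSupply, if_pos (by omega), Nat.add_sub_cancel_left]

theorem netSupply_supply (i : Fin I.n) : I.netSupply (2 * I.n + i) = 0 := by
  rw [netSupply, if_neg (by omega), if_neg (by omega)]

theorem netSupply_outliers : I.netSupply (3 * I.n) = 0 := by
  rw [netSupply, if_neg (by omega), if_neg (by omega)]

theorem netSupply_unused : I.netSupply (3 * I.n + 1) = I.totalSupply + I.m - I.totalDemand := by
  rw [netSupply, if_neg (by omega), if_pos rfl]

theorem netDemand_vertex (i : Fin I.n) : I.netDemand i = 0 := by
  rw [netDemand, if_neg (by omega), if_neg (by omega)]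

theorem netDemand_demand (i : Fin I.n) : I.netDemand (I.n + i) = 0 := by
  rw [netDemand, if_neg (by omega), if_neg (by omega)]

theorem netDemand_supply (i : Fin I.n) : I.netDemand (2 * I.n + i) = I.supplyAt i := by
  rw [netDemand, if_pos (by omega), Nat.add_sub_cancel_left]

theorem netDemand_outliers : I.netDemand (3 * I.n) = I.m := by
  rw [netDemand, if_neg (by omega), if_pos rfl]

theorem netDemand_unused : I.netDemand (3 * I.n + 1) = 0 := by
  rw [netDemand, if_neg (by omega), if_neg (by omega)]

theorem balanced_net_iff {R : Type*} [Semiring R] {z : ℕ → ℕ → R}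
    (hz : ∀ u < 3 * I.n + 2, ∀ v < 3 * I.n + 2, ¬IsArcShape I.n u v → z u v = 0) :
    Transship.Balanced (3 * I.n + 2) z (fun w => (I.netSupply w : R))
        (fun w => (I.netDemand w : R)) ↔
      (∀ i : Fin I.n, ∑ j : Fin I.n, z j i + z (I.n + i) i =
        ∑ j : Fin I.n, z i j + z i (2 * I.n + i)) ∧
      (∀ i : Fin I.n, (I.demandAt i : R) = z (I.n + i) i + z (I.n + i) (3 * I.n)) ∧
      (∀ i : Fin I.n, z i (2 * I.n + i) + z (3 * I.n + 1) (2 * I.n + i) = I.supplyAt i) ∧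
      ∑ i : Fin I.n, z (I.n + i) (3 * I.n) + z (3 * I.n + 1) (3 * I.n) = I.m ∧
      ((I.totalSupply + I.m - I.totalDemand : ℕ) : R) =
        ∑ i : Fin I.n, z (3 * I.n + 1) (2 * I.n + i) + z (3 * I.n + 1) (3 * I.n) := by
  simp only [balanced_iff hz, netSupply_vertex, netSupply_demand, netSupply_supply,
    netSupply_outliers, netSupply_unused, netDemand_vertex, netDemand_demand, netDemand_supply,
    netDemand_outliers, netDemand_unused, Nat.cast_zero, add_zero]

end NetBalance

/-- `c` is a cost matrix for the network, scaled by the common denominator `D`.  The costs of the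
arcs are at most `H`, and so a pair of nodes that is not an arc costs more than any simple path. -/
structure IsNetCost (I : MCFOInstance) (D H : ℕ) (c : ℕ → ℕ → ℕ) : Prop where
  pos : 0 < D
  edge : ∀ i j : Fin I.n, (i, j) ∈ I.E → c i j * (I.cost (i, j)).den = (I.cost (i, j)).num * D
  zero : ∀ u v, IsArcShape I.n u v → ¬(u < I.n ∧ v < I.n) → c u v = 0
  le : ∀ u v, I.IsArc u v → c u v ≤ H
  far : ∀ u < 3 * I.n + 2, ∀ v < 3 * I.n + 2, ¬I.IsArc u v → c u v = (3 * I.n + 2) * H + 1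

section Cost

variable {D H : ℕ} {c : ℕ → ℕ → ℕ}

theorem sum_node_sum_node_eq {α : Type*} [AddCommMonoid α] {n : ℕ} {g : ℕ → ℕ → α}
    (hg : ∀ u < 3 * n + 2, ∀ v < 3 * n + 2, ¬(u < n ∧ v < n) → g u v = 0) :
    ∑ u ∈ Finset.range (3 * n + 2), ∑ v ∈ Finset.range (3 * n + 2), g u v =
      ∑ e : Fin n × Fin n, g e.1 e.2 := by
  rw [Fintype.sum_prod_type, Fin.sum_univ_eq_sum_range fun u => ∑ j : Fin n, g u j,
    sum_node_eq (Finset.range n) (by simp only [Finset.mem_range]; omega)]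
  · refine Finset.sum_congr rfl fun u hu => ?_
    rw [Finset.mem_range] at hu
    rw [Fin.sum_univ_eq_sum_range (g u),
      sum_node_eq (Finset.range n) (by simp only [Finset.mem_range]; omega)]
    intro v hv hv'
    exact hg u (by omega) v hv fun h => hv' (Finset.mem_range.2 h.2)
  · intro u hu hu'
    exact Finset.sum_eq_zero fun v hv =>
      hg u hu v (Finset.mem_range.1 hv) fun h => hu' (Finset.mem_range.2 h.1)

theorem IsNetCost.cost_eq (hc : I.IsNetCost D H c) {i j : Fin I.n} (hE : (i, j) ∈ I.E) :
    (c i j : ℝ) = D * I.cost (i, j) := by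
  have h_den : ((I.cost (i, j)).den : ℝ) ≠ 0 := by exact_mod_cast (I.cost (i, j)).den_ne_zero
  have h_edge : (c i j : ℝ) * (I.cost (i, j)).den = (I.cost (i, j)).num * D := by
    exact_mod_cast hc.edge i j hE
  rw [NNRat.cast_def, ← mul_div_assoc, eq_div_iff h_den, h_edge, mul_comm]

theorem IsNetCost.sum_cost (hc : I.IsNetCost D H c) {z : ℕ → ℕ → ℝ}
    (hz : ∀ u < 3 * I.n + 2, ∀ v < 3 * I.n + 2, ¬I.IsArc u v → z u v = 0)
    (hT : ∀ i j : Fin I.n, T.flow (i, j) = z i j) :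
    ∑ u ∈ Finset.range (3 * I.n + 2), ∑ v ∈ Finset.range (3 * I.n + 2), (c u v : ℝ) * z u v =
      D * I.totalCost T := by
  rw [sum_node_sum_node_eq, totalCost, Finset.mul_sum, Finset.sum_subset (Finset.subset_univ I.E)]
  · refine Finset.sum_congr rfl fun ⟨i, j⟩ _ => ?_
    by_cases hE : (i, j) ∈ I.E
    · rw [hT, hc.cost_eq hE, mul_assoc]
    · rw [hT, hz i (by omega) j (by omega) fun h => hE (h.2 i.2 j.2), mul_zero, mul_zero, mul_zero]
  · rintro ⟨i, j⟩ _ hE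
    rw [hT, hz i (by omega) j (by omega) fun h => hE (h.2 i.2 j.2), mul_zero, mul_zero]
  · intro u hu v hv huv
    by_cases h_shape : IsArcShape I.n u v
    · rw [hc.zero u v h_shape huv, Nat.cast_zero, zero_mul]
    · rw [hz u hu v hv fun h => h_shape h.1, mul_zero]

end Cost

/-- The flow in the network that corresponds to a solution. -/
noncomputable def netFlow (T : MCFOFlow I.n ℝ) (u v : ℕ) : ℝ :=
  if h : u < I.n ∧ v < I.n then T.flow (⟨u, h.1⟩, ⟨v, h.2⟩)
  else if h : v < I.n ∧ u = I.n + v then T.served ⟨v, h.1⟩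
  else if h : (I.n ≤ u ∧ u - I.n < I.n) ∧ v = 3 * I.n then
    I.demandAt (u - I.n) - T.served ⟨u - I.n, h.1.2⟩
  else if h : u < I.n ∧ v = 2 * I.n + u then T.received ⟨u, h.1⟩
  else if h : u = 3 * I.n + 1 ∧ 2 * I.n ≤ v ∧ v - 2 * I.n < I.n then
    I.supplyAt (v - 2 * I.n) - T.received ⟨v - 2 * I.n, h.2.2⟩
  else if u = 3 * I.n + 1 ∧ v = 3 * I.n then I.m + ∑ i, T.served i - I.totalDemand
  else 0

section NetFlow

theorem netFlow_edge (i j : Fin I.n) : netFlow T i j = T.flow (i, j) := by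
  simp [netFlow]

theorem netFlow_served (i : Fin I.n) : netFlow T (I.n + i) i = T.served i := by
  simp [netFlow]

theorem netFlow_outlier (i : Fin I.n) :
    netFlow T (I.n + i) (3 * I.n) = I.demandAt i - T.served i := by
  have : ¬3 * I.n < I.n := by omega
  simp [netFlow, this]

theorem netFlow_received (i : Fin I.n) : netFlow T i (2 * I.n + i) = T.received i := by
  have h_vertex : ¬2 * I.n + i < I.n := by omega
  have h_demand : ¬I.n ≤ i := by omega
  simp [netFlow, h_vertex, h_demand]

theorem netFlow_unused (i : Fin I.n) :
    netFlow T (3 * I.n + 1) (2 * I.n + i) = I.supplyAt i - T.received i := by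
  have h_vertex : ¬2 * I.n + i < I.n := by omega
  have h_outliers : 2 * I.n + (i : ℕ) ≠ 3 * I.n := by omega
  have h_tail : ¬3 * I.n + 1 < I.n := by omega
  simp [netFlow, h_vertex, h_outliers, h_tail]

theorem netFlow_unused_outliers :
    netFlow T (3 * I.n + 1) (3 * I.n) = I.m + ∑ i, T.served i - I.totalDemand := by
  have h_head : ¬3 * I.n < I.n := by omega
  have h_demand : ¬3 * I.n + 1 - I.n < I.n := by omega
  have h_supply : ¬3 * I.n - 2 * I.n < I.n := by omega
  have h_tail : ¬3 * I.n + 1 < I.n := by omega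
  simp [netFlow, h_head, h_demand, h_supply, h_tail]

variable (h : I.IsFeasible T)

include h

theorem netFlow_nonneg (u v : ℕ) : 0 ≤ netFlow T u v := by
  unfold netFlow
  split_ifs with _ _ h_outlier _ h_unused
  · exact h.flow_nonneg _
  · exact h.served_nonneg _
  · exact sub_nonneg.2 (h.served_le_demandAt ⟨u - I.n, h_outlier.1.2⟩)
  · exact h.received_nonneg _
  · exact sub_nonneg.2 (h.received_le_supplyAt ⟨v - 2 * I.n, h_unused.2.2⟩)
  · exact sub_nonneg.2 h.totalDemand_le_sum_served
  · exact le_rfl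

theorem netFlow_eq_zero {u v : ℕ} (huv : ¬I.IsArc u v) : netFlow T u v = 0 := by
  unfold netFlow
  split_ifs with h_edge
  · exact h.flow_off _ fun hE => huv ⟨.inl h_edge, fun _ _ => hE⟩
  all_goals
    first
    | rfl
    | refine absurd ⟨?_, fun hu hv => absurd ⟨hu, hv⟩ h_edge⟩ huv
      unfold IsArcShape
      omega

theorem netFlow_balanced : Transship.Balanced (3 * I.n + 2) (netFlow T)
    (fun w => (I.netSupply w : ℝ)) fun w => (I.netDemand w : ℝ) := by
  rw [balanced_net_iff fun u _ v _ h_shape => netFlow_eq_zero h fun h' => h_shape h'.1]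
  simp only [netFlow_edge, netFlow_served, netFlow_outlier, netFlow_received, netFlow_unused,
    netFlow_unused_outliers, Finset.sum_sub_distrib, Nat.cast_sub h.totalDemand_le, Nat.cast_add,
    ← Nat.cast_sum, ← totalDemand_eq, ← totalSupply_eq, h.sum_served_eq]
  refine ⟨h.conservation, fun i => ?_, fun i => ?_, ?_, ?_⟩ <;> ring

end NetFlow

/-- The solution that corresponds to a flow in the network. -/
def solutionOf {R : Type} (I : MCFOInstance) (x : ℕ → ℕ → R) : MCFOFlow I.n R where
  flow e := x e.1 e.2
  served v := x (I.n + v) v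
  received v := x v (2 * I.n + v)

theorem isFeasible_solutionOf {z : ℕ → ℕ → ℝ} (hz_nonneg : ∀ u v, 0 ≤ z u v)
    (hz : ∀ u < 3 * I.n + 2, ∀ v < 3 * I.n + 2, ¬I.IsArc u v → z u v = 0)
    (h : Transship.Balanced (3 * I.n + 2) z (fun w => (I.netSupply w : ℝ))
      fun w => (I.netDemand w : ℝ)) : I.IsFeasible (I.solutionOf z) := by
  obtain ⟨h_vertex, h_demand, h_supply, h_outliers, -⟩ :=
    (balanced_net_iff fun u hu v hv h_shape => hz u hu v hv fun h' => h_shape h'.1).1 h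
  have served_le (i : Fin I.n) : (I.solutionOf z).served i ≤ I.demandAt i := by
    simp only [solutionOf]
    linarith [h_demand i, hz_nonneg (I.n + i) (3 * I.n)]
  have received_le (i : Fin I.n) : (I.solutionOf z).received i ≤ I.supplyAt i := by
    simp only [solutionOf]
    linarith [h_supply i, hz_nonneg (3 * I.n + 1) (2 * I.n + i)]
  have served_off (i : Fin I.n) (hi : i ∉ I.C) : (I.solutionOf z).served i = 0 :=
    le_antisymm (by simpa [demandAt_coe, hi] using served_le i) (hz_nonneg _ _)
  refine ⟨fun _ => hz_nonneg _ _, ?_, fun _ => hz_nonneg _ _, ?_, served_off,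
    fun _ => hz_nonneg _ _, ?_, ?_, h_vertex, ?_⟩
  · rintro ⟨i, j⟩ hE
    exact hz i (by omega) j (by omega) fun h => hE (h.2 i.2 j.2)
  · intro i hi
    simpa [demandAt_coe, hi] using served_le i
  · intro i hi
    simpa [supplyAt_coe, hi] using received_le i
  · intro i hi
    exact le_antisymm (by simpa [supplyAt_coe, hi] using received_le i) (hz_nonneg _ _)
  · have h_sum := Fintype.sum_congr _ _ h_demand
    rw [Finset.sum_add_distrib, ← Nat.cast_sum, ← totalDemand_eq] at h_sum
    rw [sum_demand_eq_totalDemand,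
      Finset.sum_subset (Finset.subset_univ I.C) fun i _ hi => served_off i hi]
    simp only [solutionOf]
    linarith [hz_nonneg (3 * I.n + 1) (3 * I.n)]

section Optimal

variable {D H : ℕ} {c x : ℕ → ℕ → ℕ} {π : ℕ → ℕ} (hc : I.IsNetCost D H c)
  (hπ : IsCertificate (3 * I.n + 2) c x π)
  (hx : Transship.Balanced (3 * I.n + 2) x I.netSupply I.netDemand)

include hc hπ hx

theorem isOptimal_solutionOf
    (hz : ∀ u < 3 * I.n + 2, ∀ v < 3 * I.n + 2, ¬I.IsArc u v → x u v = 0) :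
    I.IsOptimal (I.solutionOf x).toReal := by
  have hz_cast : ∀ u < 3 * I.n + 2, ∀ v < 3 * I.n + 2, ¬I.IsArc u v → (x u v : ℝ) = 0 :=
    fun u hu v hv huv => by rw [hz u hu v hv huv, Nat.cast_zero]
  refine ⟨isFeasible_solutionOf (fun _ _ => Nat.cast_nonneg _) hz_cast hx.natCast, fun T hT => ?_⟩
  have h_le := hπ.sum_mul_le hx.natCast (netFlow_balanced hT) fun u _ v _ => netFlow_nonneg hT u v
  rw [hc.sum_cost (T := T) (fun u _ v _ => netFlow_eq_zero hT) fun i j => (netFlow_edge i j).symm,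
    hc.sum_cost (T := (I.solutionOf x).toReal) hz_cast fun _ _ => rfl] at h_le
  exact le_of_mul_le_mul_left h_le (Nat.cast_pos.2 hc.pos)

theorem IsFeasible.flow_eq_zero (hT : I.IsFeasible T) {u v : ℕ} (hu : u < 3 * I.n + 2)
    (hv : v < 3 * I.n + 2) (huv : ¬I.IsArc u v) : x u v = 0 := by
  refine hπ.flow_eq_zero hx.natCast (netFlow_balanced hT) (fun a _ b _ => netFlow_nonneg hT a b)
    (fun a _ b _ hab => hc.le a b ?_) hu hv (by rw [hc.far u hu v hv huv]; exact Nat.lt_succ_self _)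
  by_contra h_arc
  exact hab (netFlow_eq_zero hT h_arc)

end Optimal

section Balances

variable {I : MCFOInstance}

theorem sum_nodes {α : Type*} [AddCommMonoid α] {n : ℕ} (f : ℕ → α) :
    ∑ w ∈ Finset.range (3 * n + 2), f w = ∑ i : Fin n, f i + ∑ i : Fin n, f (n + i) +
      ∑ i : Fin n, f (2 * n + i) + f (3 * n) + f (3 * n + 1) := by
  rw [Fin.sum_univ_eq_sum_range, Fin.sum_univ_eq_sum_range fun i => f (n + i),
    Fin.sum_univ_eq_sum_range fun i => f (2 * n + i), ← Finset.sum_range_add, ← two_mul,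
    ← Finset.sum_range_add, show 2 * n + n = 3 * n by ring, ← Finset.sum_range_succ,
    ← Finset.sum_range_succ]

theorem sum_netDemand :
    ∑ w ∈ Finset.range (3 * I.n + 2), I.netDemand w = I.totalSupply + I.m := by
  simp only [sum_nodes, netDemand_vertex, netDemand_demand, netDemand_supply, netDemand_outliers,
    netDemand_unused, totalSupply_eq, Finset.sum_const_zero, zero_add, add_zero]

theorem sum_netSupply (h : I.totalDemand ≤ I.totalSupply + I.m) :
    ∑ w ∈ Finset.range (3 * I.n + 2), I.netSupply w = I.totalSupply + I.m := by
  simp only [sum_nodes, netSupply_vertex, netSupply_demand, netSupply_supply, netSupply_outliers,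
    netSupply_unused, ← totalDemand_eq, Finset.sum_const_zero, zero_add, add_zero]
  exact Nat.add_sub_of_le h

end Balances

section Encoding

theorem length_flatMap_finRange {n k : ℕ} {f : Fin n → List ℕ} (hf : ∀ i, (f i).length = k) :
    ((List.finRange n).flatMap f).length = k * n := by
  simp [List.length_flatMap, hf, mul_comm]

theorem getD_flatMap_finRange {n k r : ℕ} {f : Fin n → List ℕ} (hf : ∀ i, (f i).length = k)
    (i : Fin n) (hr : r < k) (l : List ℕ) :
    ((List.finRange n).flatMap f ++ l).getD (k * i + r) 0 = (f i).getD r 0 := by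
  induction n generalizing l with
  | zero => exact i.elim0
  | succ n ih =>
    rw [List.finRange_succ, List.flatMap_cons, List.flatMap_map, List.append_assoc]
    refine Fin.cases ?_ (fun i => ?_) i
    · rw [List.getD_append _ _ _ _ (by simpa [hf] using hr), Fin.val_zero, mul_zero, zero_add]
    · have h_index : k * (i.succ : ℕ) + r = k + (k * i + r) := by rw [Fin.val_succ]; ring
      rw [h_index, List.getD_append_right _ _ _ _ (by simp [hf]), hf, Nat.add_sub_cancel_left,
        ih (fun i => hf i.succ)]

variable {I : MCFOInstance}

/-- The initial contents of the input array. -/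
def input (I : MCFOInstance) : ℕ → ℕ := RAM.initial I.encode 0

/-- The number with index `r` of the three numbers in the input for the pair `(u, v)` of vertices:
whether it is an edge, and the numerator and the denominator of its cost. -/
def pairEntry (I : MCFOInstance) (r u v : ℕ) : ℕ :=
  I.input (3 + r + 4 * I.n + 3 * (u * I.n + v))

theorem input_succ (k : ℕ) : I.input (k + 1) = I.encode.getD k 0 := by
  simp [input, RAM.initial]

theorem input_one : I.input 1 = I.n := by
  rw [input_succ]; rfl

theorem input_two : I.input 2 = I.m := by
  rw [input_succ]; rfl

theorem input_add_three (k : ℕ) : I.input (3 + k) =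
    ((List.finRange I.n).flatMap (fun v => if v ∈ I.C then [1, I.demand v] else [0, 0]) ++
      ((List.finRange I.n).flatMap (fun v => if v ∈ I.F then [1, I.supply v] else [0, 0]) ++
        ((List.finRange I.n).flatMap (fun u => (List.finRange I.n).flatMap fun v =>
          if (u, v) ∈ I.E then [1, (I.cost (u, v)).num, (I.cost (u, v)).den]
          else [0, 0, 0]) ++ []))).getD k 0 := by
  rw [show 3 + k = k + 2 + 1 by ring, input_succ]
  simp only [encode, List.append_assoc, List.cons_append, List.nil_append, List.getD_cons_succ,
    List.append_nil]

theorem length_if {p : Prop} [Decidable p] {l₁ l₂ : List ℕ} {k : ℕ} (h₁ : l₁.length = k)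
    (h₂ : l₂.length = k) : (if p then l₁ else l₂).length = k := by
  split_ifs <;> assumption

theorem input_demand {k : ℕ} (hk : k < I.n) : I.input (4 + 2 * k) = I.demandAt k := by
  rw [show 4 + 2 * k = 3 + (2 * k + 1) by ring, input_add_three,
    getD_flatMap_finRange (k := 2) (fun i => length_if rfl rfl) ⟨k, hk⟩ one_lt_two,
    demandAt, dif_pos hk]
  split_ifs <;> rfl

theorem input_supply {k : ℕ} (hk : k < I.n) : I.input (4 + 2 * I.n + 2 * k) = I.supplyAt k := by
  have h_length := length_flatMap_finRange (k := 2)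
    (f := fun v => if v ∈ I.C then [1, I.demand v] else [0, 0]) fun i => length_if rfl rfl
  rw [show 4 + 2 * I.n + 2 * k = 3 + (2 * I.n + (2 * k + 1)) by ring, input_add_three,
    List.getD_append_right _ _ _ _ (by rw [h_length]; exact Nat.le_add_right _ _), h_length,
    Nat.add_sub_cancel_left,
    getD_flatMap_finRange (k := 2) (fun i => length_if rfl rfl) ⟨k, hk⟩ one_lt_two,
    supplyAt, dif_pos hk]
  split_ifs <;> rfl

theorem pairEntry_coe (i j : Fin I.n) {r : ℕ} (hr : r < 3) : I.pairEntry r i j =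
    (if (i, j) ∈ I.E then [1, (I.cost (i, j)).num, (I.cost (i, j)).den]
      else [0, 0, 0]).getD r 0 := by
  have h_length₁ := length_flatMap_finRange (k := 2)
    (f := fun v => if v ∈ I.C then [1, I.demand v] else [0, 0]) fun i => length_if rfl rfl
  have h_length₂ := length_flatMap_finRange (k := 2)
    (f := fun v => if v ∈ I.F then [1, I.supply v] else [0, 0]) fun i => length_if rfl rfl
  have h_triple (i j : Fin I.n) : (if (i, j) ∈ I.E then
      [1, (I.cost (i, j)).num, (I.cost (i, j)).den] else [0, 0, 0]).length = 3 := length_if rfl rfl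
  rw [pairEntry, show 3 + r + 4 * I.n + 3 * ((i : ℕ) * I.n + j) =
      3 + (2 * I.n + (2 * I.n + (3 * I.n * i + (3 * j + r)))) by ring, input_add_three,
    List.getD_append_right _ _ _ _ (by rw [h_length₁]; exact Nat.le_add_right _ _), h_length₁,
    Nat.add_sub_cancel_left,
    List.getD_append_right _ _ _ _ (by rw [h_length₂]; exact Nat.le_add_right _ _), h_length₂,
    Nat.add_sub_cancel_left,
    getD_flatMap_finRange (fun i => length_flatMap_finRange (h_triple i)) i (by omega),
    ← List.append_nil (List.flatMap _ _), getD_flatMap_finRange (h_triple i) j hr]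

theorem pairEntry_zero_ne_zero (i j : Fin I.n) : I.pairEntry 0 i j ≠ 0 ↔ (i, j) ∈ I.E := by
  rw [pairEntry_coe i j (by norm_num)]
  split_ifs with h <;> simp [h]

theorem pairEntry_one {i j : Fin I.n} (h : (i, j) ∈ I.E) :
    I.pairEntry 1 i j = (I.cost (i, j)).num := by
  rw [pairEntry_coe i j (by norm_num), if_pos h]; rfl

theorem pairEntry_two {i j : Fin I.n} (h : (i, j) ∈ I.E) :
    I.pairEntry 2 i j = (I.cost (i, j)).den := by
  rw [pairEntry_coe i j (by norm_num), if_pos h]; rfl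

theorem pairEntry_two_pos {u v : ℕ} (hu : u < I.n) (hv : v < I.n) (h : I.pairEntry 0 u v ≠ 0) :
    0 < I.pairEntry 2 u v := by
  lift u to Fin I.n using hu
  lift v to Fin I.n using hv
  rw [pairEntry_two ((pairEntry_zero_ne_zero u v).1 h)]
  exact (I.cost (u, v)).den_pos

/-- `D` is a common denominator of the costs of the edges in the set `S` of pairs of vertices, and
`H` is a bound for `D` and for these costs after they have been multiplied by `D`. -/
structure IsCommonDenominator (I : MCFOInstance) (S : Set (ℕ × ℕ)) (D H : ℕ) : Prop where
  pos : 0 < D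
  le : D ≤ H
  dvd : ∀ p ∈ S, I.pairEntry 0 p.1 p.2 ≠ 0 → I.pairEntry 2 p.1 p.2 ∣ D
  mul_le : ∀ p ∈ S, I.pairEntry 0 p.1 p.2 ≠ 0 → I.pairEntry 1 p.1 p.2 * D ≤ H

variable {S : Set (ℕ × ℕ)} {D H u v : ℕ}

theorem IsCommonDenominator.insert_edge (h : I.IsCommonDenominator S D H)
    (huv : 0 < I.pairEntry 2 u v) :
    I.IsCommonDenominator (insert (u, v) S) (I.pairEntry 2 u v * D)
      (I.pairEntry 2 u v * (I.pairEntry 1 u v * H + H)) where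
  pos := Nat.mul_pos huv h.pos
  le := Nat.mul_le_mul_left _ (h.le.trans (Nat.le_add_left _ _))
  dvd := by
    rintro p (rfl | hp) h₀
    · exact dvd_mul_right _ _
    · exact (h.dvd p hp h₀).mul_left _
  mul_le := by
    rintro p (rfl | hp) h₀ <;> rw [mul_left_comm]
    · exact Nat.mul_le_mul_left _ ((Nat.mul_le_mul_left _ h.le).trans (Nat.le_add_right _ _))
    · exact Nat.mul_le_mul_left _ ((h.mul_le p hp h₀).trans (Nat.le_add_left _ _))

theorem IsCommonDenominator.insert_nonedge (h : I.IsCommonDenominator S D H)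
    (huv : I.pairEntry 0 u v = 0) : I.IsCommonDenominator (insert (u, v) S) D H where
  pos := h.pos
  le := h.le
  dvd := by
    rintro p (rfl | hp) h₀
    · exact absurd huv h₀
    · exact h.dvd p hp h₀
  mul_le := by
    rintro p (rfl | hp) h₀
    · exact absurd huv h₀
    · exact h.mul_le p hp h₀

end Encoding

end MCFOInstance

namespace RAM

/-! ### Running times in the random access machine -/

namespace Expr

instance : Add Expr := ⟨add⟩
instance : Sub Expr := ⟨sub⟩
instance : Mul Expr := ⟨mul⟩
instance : Div Expr := ⟨div⟩
instance (k : ℕ) : OfNat Expr k := ⟨const k⟩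

/-- The number of nodes of an expression, where a constant contributes its bit length as well. -/
def weight : Expr → ℕ
  | const k => Nat.size k + 1
  | get _ e => e.weight + 1
  | add e₁ e₂ => e₁.weight + e₂.weight + 1
  | sub e₁ e₂ => e₁.weight + e₂.weight + 1
  | mul e₁ e₂ => e₁.weight + e₂.weight + 1
  | div e₁ e₂ => e₁.weight + e₂.weight + 1

/-- An expression is tame if, outside of addresses, the left factor of each product is a cell of
the input array `0`.  Storing the value of a tame expression increases the maximal bit length of
the cells by a bounded multiple of the bit length of the input, whereas iterating an untame
assignment like `x := x * x` doubles it every time. -/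
def tame : Expr → Bool
  | const _ => true
  | get _ _ => true
  | add e₁ e₂ => e₁.tame && e₂.tame
  | sub e₁ e₂ => e₁.tame && e₂.tame
  | mul (get 0 _) e₂ => e₂.tame
  | mul _ _ => false
  | div e₁ e₂ => e₁.tame && e₂.tame

end Expr

/-- The cells of the input array have at most `X` bits, and all cells have at most `L` bits. -/
structure State.Bounded (s : State) (X L : ℕ) : Prop where
  size_input_le : ∀ i, Nat.size (s 0 i) ≤ X
  size_le : ∀ a i, Nat.size (s a i) ≤ L

theorem State.Bounded.mono {s : State} {X L L' : ℕ} (hs : s.Bounded X L) (h : L ≤ L') :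
    s.Bounded X L' :=
  ⟨hs.size_input_le, fun a i => (hs.size_le a i).trans h⟩

theorem size_add_le_max (a b : ℕ) : Nat.size (a + b) ≤ max (Nat.size a) (Nat.size b) + 1 := by
  rw [Nat.size_le, pow_succ]
  have ha := Nat.size_le.1 (le_max_left (Nat.size a) (Nat.size b))
  have hb := Nat.size_le.1 (le_max_right (Nat.size a) (Nat.size b))
  omega

theorem size_mul_le (a b : ℕ) : Nat.size (a * b) ≤ Nat.size a + Nat.size b := by
  rw [Nat.size_le, pow_add]
  exact Nat.mul_lt_mul'' (Nat.lt_size_self a) (Nat.lt_size_self b)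

theorem size_sub_le (a b : ℕ) : Nat.size (a - b) ≤ Nat.size a :=
  Nat.size_le_size (Nat.sub_le a b)

theorem size_div_le (a b : ℕ) : Nat.size (a / b) ≤ Nat.size a :=
  Nat.size_le_size (Nat.div_le_self a b)

section Expr

variable {s : State} {X L : ℕ}

theorem Expr.size_val_le (hs : s.Bounded X L) (e : Expr) :
    Nat.size (e.val s) ≤ e.weight * (L + 1) := by
  induction e with
  | const k => simp only [val, weight]; nlinarith
  | get a e _ => simp only [val, weight]; nlinarith [hs.size_le a (e.val s)]
  | add e₁ e₂ h₁ h₂ =>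
    simp only [val, weight, add_mul]
    have := size_add_le_max (e₁.val s) (e₂.val s)
    omega
  | sub e₁ e₂ h₁ _ =>
    simp only [val, weight, add_mul]
    have := size_sub_le (e₁.val s) (e₂.val s)
    omega
  | mul e₁ e₂ h₁ h₂ =>
    simp only [val, weight, add_mul]
    have := size_mul_le (e₁.val s) (e₂.val s)
    omega
  | div e₁ e₂ h₁ _ =>
    simp only [val, weight, add_mul]
    have := size_div_le (e₁.val s) (e₂.val s)
    omega

theorem Expr.time_le (hs : s.Bounded X L) (e : Expr) {W : ℕ} (hW : e.weight * (L + 1) ≤ W) :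
    e.time s ≤ e.weight * (W + 1) := by
  have hv := (e.size_val_le hs).trans hW
  induction e with
  | const k => simp only [time, weight, val] at *; nlinarith
  | get a e ih =>
    simp only [time, weight, add_mul] at *
    have := ih (by omega) ((e.size_val_le hs).trans (by omega))
    omega
  | add e₁ e₂ h₁ h₂ | sub e₁ e₂ h₁ h₂ | mul e₁ e₂ h₁ h₂ | div e₁ e₂ h₁ h₂ =>
    simp only [time, weight, add_mul] at *
    have := h₁ (by omega) ((e₁.size_val_le hs).trans (by omega))
    have := h₂ (by omega) ((e₂.size_val_le hs).trans (by omega))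
    omega

theorem Expr.size_val_le_of_tame (hs : s.Bounded X L) {e : Expr} (he : e.tame) :
    Nat.size (e.val s) ≤ L + e.weight * (X + 1) := by
  fun_induction tame e with
  | case1 k => simp only [val, weight]; nlinarith
  | case2 a e => simp only [val]; exact (hs.size_le a _).trans (Nat.le_add_right _ _)
  | case3 e₁ e₂ h₁ h₂ =>
    obtain ⟨he₁, he₂⟩ := Bool.and_eq_true_iff.1 he
    have := size_add_le_max (e₁.val s) (e₂.val s)
    have := h₁ he₁
    have := h₂ he₂
    simp only [val, weight, add_mul]
    omega
  | case4 e₁ e₂ h₁ _ =>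
    have := size_sub_le (e₁.val s) (e₂.val s)
    have := h₁ (Bool.and_eq_true_iff.1 he).1
    simp only [val, weight, add_mul]
    omega
  | case5 e₁ e₂ h₂ =>
    have := size_mul_le (s 0 (e₁.val s)) (e₂.val s)
    have := hs.size_input_le (e₁.val s)
    have := h₂ he
    simp only [val, weight, add_mul]
    omega
  | case6 => contradiction
  | case7 e₁ e₂ h₁ _ =>
    have := size_div_le (e₁.val s) (e₂.val s)
    have := h₁ (Bool.and_eq_true_iff.1 he).1
    simp only [val, weight, add_mul]
    omega

end Expr

theorem State.set_of_ne (s : State) {a b : ℕ} (i x : ℕ) (h : b ≠ a) : s.set a i x b = s b :=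
  Function.update_of_ne h _ _

theorem State.set_same (s : State) (a i x : ℕ) : s.set a i x a = Function.update (s a) i x :=
  Function.update_self _ _ _

theorem State.set_apply (s : State) (a i x b j : ℕ) :
    s.set a i x b j = if b = a ∧ j = i then x else s b j := by
  rcases eq_or_ne b a with rfl | hb
  · simp [set_same, Function.update_apply]
  · simp [set_of_ne _ _ _ hb, hb]

theorem State.Bounded.set {s : State} {X L a i x : ℕ} (hs : s.Bounded X L) (ha : a ≠ 0)
    (hx : Nat.size x ≤ L) : (s.set a i x).Bounded X L where
  size_input_le j := by rw [State.set_of_ne _ _ _ ha.symm]; exact hs.size_input_le j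
  size_le b j := by
    rw [State.set_apply]
    split_ifs
    · exact hx
    · exact hs.size_le b j

namespace Program

/-- A program is tame if it never writes the input array and stores only values of tame
expressions. -/
def tame : Program → Bool
  | skip => true
  | assign a _ e => (a != 0) && e.tame
  | seq c₁ c₂ => c₁.tame && c₂.tame
  | ite _ c₁ c₂ => c₁.tame && c₂.tame
  | loop _ c => c.tame

open Polynomial in
/-- A bound for the growth of the bit lengths of the cells during a run of a tame program, as a
polynomial in a bound for the bit lengths of the input cells and for the number of iterations of
every loop. -/
noncomputable def growth : Program → ℕ[X]
  | skip => 0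
  | assign _ _ e => C e.weight * (X + 1)
  | seq c₁ c₂ => c₁.growth + c₂.growth
  | ite _ c₁ c₂ => c₁.growth + c₂.growth
  | loop _ c => X * c.growth

end Program

open Polynomial in
/-- A bound for the time for evaluating an expression in a memory with bit lengths at most `l`. -/
noncomputable def Expr.timeBound (e : Expr) (l : ℕ[X]) : ℕ[X] :=
  C e.weight * (C e.weight * (l + 1) + 1)

open Polynomial in
/-- A bound for the running time of a tame program, in the same quantity as `Program.growth`, if
the memory initially has bit lengths at most `l`. -/
noncomputable def Program.timeBound : Program → ℕ[X] → ℕ[X]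
  | skip, _ => 1
  | assign _ i e, l => i.timeBound l + e.timeBound l + 1
  | seq c₁ c₂, l => c₁.timeBound l + c₂.timeBound (l + c₁.growth) + 1
  | ite e c₁ c₂, l => e.timeBound l + c₁.timeBound l + c₂.timeBound l + 1
  | loop e c, l => (X + 1) * (e.timeBound (l + X * c.growth) + c.timeBound (l + X * c.growth) + 1)

theorem Expr.time_le_eval_timeBound {s : State} {L X : ℕ} {l : Polynomial ℕ}
    (hs : s.Bounded X L) (hl : L ≤ l.eval X) (e : Expr) : e.time s ≤ (e.timeBound l).eval X := by
  simp only [Expr.timeBound, Polynomial.eval_mul, Polynomial.eval_add, Polynomial.eval_C,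
    Polynomial.eval_one]
  exact e.time_le hs (Nat.mul_le_mul_left _ (Nat.add_le_add_right hl 1))

/-- Total correctness with a time bound: started in `s`, the program `c` halts within time `T` in a
state with `Q`. -/
def HaltsWithin (T : ℕ) (c : Program) (Q : State → Prop) (s : State) : Prop :=
  ∃ t s', Exec c s t s' ∧ t ≤ T ∧ Q s'

namespace HaltsWithin

variable {T T₁ T₂ : ℕ} {c c₁ c₂ : Program} {e : Expr} {Q Q' : State → Prop} {s : State}

theorem mono (h : HaltsWithin T₁ c Q s) (hT : T₁ ≤ T₂) (hQ : ∀ s', Q s' → Q' s') :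
    HaltsWithin T₂ c Q' s :=
  let ⟨t, s', he, ht, hq⟩ := h
  ⟨t, s', he, ht.trans hT, hQ s' hq⟩

theorem seq (h : HaltsWithin T₁ c₁ (HaltsWithin T₂ c₂ Q) s) :
    HaltsWithin (T₁ + T₂ + 1) (.seq c₁ c₂) Q s :=
  let ⟨_, _, he₁, ht₁, _, s₂, he₂, ht₂, hq⟩ := h
  ⟨_, s₂, .seq he₁ he₂, by omega, hq⟩

theorem ite_true (hv : e.val s ≠ 0) (h : HaltsWithin T c₁ Q s) :
    HaltsWithin (e.time s + T + 1) (.ite e c₁ c₂) Q s :=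
  let ⟨_, s', he, ht, hq⟩ := h
  ⟨_, s', .ite_true hv he, by omega, hq⟩

theorem ite_false (hv : e.val s = 0) (h : HaltsWithin T c₂ Q s) :
    HaltsWithin (e.time s + T + 1) (.ite e c₁ c₂) Q s :=
  let ⟨_, s', he, ht, hq⟩ := h
  ⟨_, s', .ite_false hv he, by omega, hq⟩

theorem loop_step (hv : e.val s ≠ 0) (h : HaltsWithin T₁ c (HaltsWithin T₂ (.loop e c) Q) s) :
    HaltsWithin (e.time s + T₁ + T₂ + 1) (.loop e c) Q s :=
  let ⟨_, _, he₁, ht₁, _, s₂, he₂, ht₂, hq⟩ := h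
  ⟨_, s₂, .loop_step hv he₁ he₂, by omega, hq⟩

end HaltsWithin

/-! ### Weakest preconditions -/

/-- If `F` yields the weakest preconditions of the body of a loop with test `e`, then
`wpLoop e F k` yields those of the loop, restricted to at most `k` iterations. -/
def wpLoop (e : Expr) (F : (State → Prop) → State → Prop) : ℕ → (State → Prop) → State → Prop
  | 0, Q, s => e.val s = 0 ∧ Q s
  | k + 1, Q, s => (e.val s = 0 ∧ Q s) ∨ (e.val s ≠ 0 ∧ F (wpLoop e F k Q) s)

/-- The weakest precondition for a program to halt in a state with `Q` such that no execution of a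
loop makes more than `R` iterations. -/
def wp (R : ℕ) : Program → (State → Prop) → State → Prop
  | .skip, Q, s => Q s
  | .assign a i e, Q, s => Q (s.set a (i.val s) (e.val s))
  | .seq c₁ c₂, Q, s => wp R c₁ (wp R c₂ Q) s
  | .ite e c₁ c₂, Q, s => (e.val s ≠ 0 → wp R c₁ Q s) ∧ (e.val s = 0 → wp R c₂ Q s)
  | .loop e c, Q, s => wpLoop e (wp R c) R Q s

/-- After `i` iterations the cells have at most `g * i` bits more than initially, so a time bound
`B` for the test and the body that covers all these bit lengths may be used throughout. -/
theorem haltsWithin_of_wpLoop {X g T B : ℕ} {e : Expr} {c : Program} {Q : State → Prop}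
    (hbody : ∀ Q s L, L ≤ B → s.Bounded X L → wp X c Q s →
      HaltsWithin T c (fun s' => s'.Bounded X (L + g) ∧ Q s') s)
    {Tₑ : ℕ} (htest : ∀ s L, L ≤ B → s.Bounded X L → e.time s ≤ Tₑ) {k : ℕ} :
    ∀ {s L}, L + k * g ≤ B → s.Bounded X L → wpLoop e (wp X c) k Q s →
      HaltsWithin ((k + 1) * (Tₑ + T + 1)) (.loop e c)
        (fun s' => s'.Bounded X (L + k * g) ∧ Q s') s := by
  induction k with
  | zero =>
    rintro s L hL hs ⟨hv, hq⟩
    have := htest s L (by omega) hs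
    exact ⟨_, s, .loop_done hv, by omega, by simpa using hs, hq⟩
  | succ k ih =>
    intro s L hL hs h
    rw [add_one_mul] at hL
    have ht := htest s L (by omega) hs
    rcases h with ⟨hv, hq⟩ | ⟨hv, hq⟩
    · exact ⟨_, s, .loop_done hv, by nlinarith, hs.mono (by omega), hq⟩
    · have hrest := (hbody _ s L (by omega) hs hq).mono le_rfl
        fun s₁ h₁ => ih (L := L + g) (by omega) h₁.1 h₁.2
      refine hrest.loop_step hv |>.mono ?_ fun s' h' => ⟨h'.1.mono ?_, h'.2⟩
      · rw [add_one_mul (k + 1)]; omega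
      · rw [add_one_mul]; omega

theorem haltsWithin_of_wp {X : ℕ} {c : Program} (hc : c.tame) {Q : State → Prop} {s : State}
    {L : ℕ} {l : Polynomial ℕ} (hl : L ≤ l.eval X) (hs : s.Bounded X L) (h : wp X c Q s) :
    HaltsWithin ((c.timeBound l).eval X) c
      (fun s' => s'.Bounded X (L + c.growth.eval X) ∧ Q s') s := by
  induction c generalizing Q s L l with
  | skip => exact ⟨1, s, .skip s, by simp [Program.timeBound], by simpa [Program.growth], h⟩
  | assign a i e =>
    simp only [Program.tame, Bool.and_eq_true, bne_iff_ne] at hc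
    refine ⟨_, _, .assign s a i e, ?_, (hs.mono (Nat.le_add_right _ _)).set hc.1 ?_, h⟩
    · have := i.time_le_eval_timeBound hs hl
      have := e.time_le_eval_timeBound hs hl
      simp only [Program.timeBound, Polynomial.eval_add, Polynomial.eval_one]
      omega
    · simpa [Program.growth] using Expr.size_val_le_of_tame hs hc.2
  | seq c₁ c₂ ih₁ ih₂ =>
    simp only [Program.tame, Bool.and_eq_true] at hc
    have hrun := HaltsWithin.seq <| (ih₁ hc.1 hl hs h).mono le_rfl fun s₁ h₁ =>
      ih₂ hc.2 (l := l + c₁.growth) (by rw [Polynomial.eval_add]; omega) h₁.1 h₁.2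
    refine hrun.mono ?_ fun s' h' => ⟨?_, h'.2⟩
    · simp [Program.timeBound]
    · simpa [Program.growth, add_assoc] using h'.1
  | ite e c₁ c₂ ih₁ ih₂ =>
    simp only [Program.tame, Bool.and_eq_true] at hc
    have ht := e.time_le_eval_timeBound hs hl
    simp only [Program.timeBound, Program.growth, Polynomial.eval_add, Polynomial.eval_one]
    by_cases hv : e.val s = 0
    · exact ((ih₂ hc.2 hl hs (h.2 hv)).ite_false hv).mono (by omega)
        fun s' h' => ⟨h'.1.mono (by omega), h'.2⟩
    · exact ((ih₁ hc.1 hl hs (h.1 hv)).ite_true hv).mono (by omega)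
        fun s' h' => ⟨h'.1.mono (by omega), h'.2⟩
  | loop e c ih =>
    set l' := l + Polynomial.X * c.growth with hl'
    have hle : L + X * c.growth.eval X ≤ l'.eval X := by
      simpa [hl'] using hl
    have hrun := haltsWithin_of_wpLoop (B := l'.eval X)
      (fun Q s L hL hs h => ih hc (l := l') hL hs h)
      (fun s L hL hs => e.time_le_eval_timeBound hs hL) hle hs h
    simpa [Program.timeBound, Program.growth] using hrun

variable {R : ℕ} {Q Q' : State → Prop} {s s' s₁ s₂ : State}

/-- Some assignment of the program stores into the array `a`. -/
def Program.writes (a : ℕ) : Program → Bool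
  | .skip => false
  | .assign b _ _ => a == b
  | .seq c₁ c₂ => c₁.writes a || c₂.writes a
  | .ite _ c₁ c₂ => c₁.writes a || c₂.writes a
  | .loop _ c => c.writes a

/-- The frame condition: `s'` agrees with `s` on all arrays into which `c` does not store. -/
def Program.Frame (c : Program) (s s' : State) : Prop :=
  ∀ a, c.writes a = false → s' a = s a

namespace Program.Frame

variable {c c' : Program}

theorem refl (c : Program) (s : State) : c.Frame s s := fun _ _ => rfl

theorem trans (h₁ : c.Frame s s₁) (h₂ : c.Frame s₁ s₂) : c.Frame s s₂ :=
  fun a ha => (h₂ a ha).trans (h₁ a ha)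

theorem mono (h : c.Frame s s') (hc : ∀ a, c'.writes a = false → c.writes a = false) :
    c'.Frame s s' :=
  fun a ha => h a (hc a ha)

theorem array (h : c.Frame s s') (a : ℕ) (ha : c.writes a = false := by decide) : s' a = s a :=
  h a ha

theorem var (h : c.Frame s s') (a : ℕ) (ha : c.writes a = false := by decide) :
    s' a 0 = s a 0 :=
  congrFun (h a ha) 0

end Program.Frame

theorem wpLoop_mono {e : Expr} {F : (State → Prop) → State → Prop}
    (hF : ∀ Q Q' s, F Q s → (∀ s', Q s' → Q' s') → F Q' s) {k : ℕ} (h : wpLoop e F k Q s)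
    (hQ : ∀ s', Q s' → Q' s') : wpLoop e F k Q' s := by
  induction k generalizing s with
  | zero => exact ⟨h.1, hQ _ h.2⟩
  | succ k ih => exact h.imp (fun h => ⟨h.1, hQ _ h.2⟩) fun h => ⟨h.1, hF _ _ _ h.2 fun _ => ih⟩

theorem wp_mono {c : Program} (h : wp R c Q s) (hQ : ∀ s', Q s' → Q' s') : wp R c Q' s := by
  induction c generalizing Q Q' s with
  | skip => exact hQ _ h
  | assign a i e => exact hQ _ h
  | seq c₁ c₂ h₁ h₂ => exact h₁ h fun s₁ h' => h₂ h' hQ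
  | ite e c₁ c₂ h₁ h₂ => exact ⟨fun hv => h₁ (h.1 hv) hQ, fun hv => h₂ (h.2 hv) hQ⟩
  | loop e c ih => exact wpLoop_mono (F := wp R c) (fun _ _ _ => ih) h hQ

theorem wpLoop_frame {e : Expr} {c : Program}
    (hc : ∀ {Q s}, wp R c Q s → wp R c (fun s' => Q s' ∧ c.Frame s s') s) {k : ℕ}
    (h : wpLoop e (wp R c) k Q s) :
    wpLoop e (wp R c) k (fun s' => Q s' ∧ c.Frame s s') s := by
  induction k generalizing s with
  | zero => exact ⟨h.1, h.2, .refl c s⟩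
  | succ k ih =>
    refine h.imp (fun h => ⟨h.1, h.2, .refl c s⟩) fun h => ⟨h.1, wp_mono (hc h.2) ?_⟩
    rintro s₁ ⟨hs₁, f₁⟩
    exact wpLoop_mono (F := wp R c) (fun _ _ _ => wp_mono) (ih hs₁) fun s₂ h₂ =>
      ⟨h₂.1, f₁.trans h₂.2⟩

theorem wp_frame {c : Program} (h : wp R c Q s) : wp R c (fun s' => Q s' ∧ c.Frame s s') s := by
  induction c generalizing Q s with
  | skip => exact ⟨h, .refl _ s⟩
  | assign a i e =>
    exact ⟨h, fun b hb => State.set_of_ne _ _ _ (by simpa [Program.writes] using hb)⟩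
  | seq c₁ c₂ h₁ h₂ =>
    refine wp_mono (c := c₁) (h₁ h) fun s₁ ⟨hs₁, f₁⟩ =>
      wp_mono (h₂ hs₁) fun s₂ ⟨hs₂, f₂⟩ => ⟨hs₂, ?_⟩
    intro a ha
    obtain ⟨ha₁, ha₂⟩ := Bool.or_eq_false_iff.1 ha
    exact (f₂ a ha₂).trans (f₁ a ha₁)
  | ite e c₁ c₂ h₁ h₂ =>
    exact ⟨fun hv => wp_mono (h₁ (h.1 hv)) fun s' h' =>
        ⟨h'.1, h'.2.mono fun a ha => (Bool.or_eq_false_iff.1 ha).1⟩,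
      fun hv => wp_mono (h₂ (h.2 hv)) fun s' h' =>
        ⟨h'.1, h'.2.mono fun a ha => (Bool.or_eq_false_iff.1 ha).2⟩⟩
  | loop e c ih => exact wpLoop_frame ih h

theorem wp_seq_frame {c₁ c₂ : Program} {Q₁ : State → Prop} (h₁ : wp R c₁ Q₁ s)
    (h₂ : ∀ s₁, c₁.Frame s s₁ → Q₁ s₁ → wp R c₂ Q s₁) : wp R (.seq c₁ c₂) Q s :=
  wp_mono (c := c₁) (wp_frame h₁) fun s₁ h => h₂ s₁ h.2 h.1

theorem wpLoop_of_invariant {e : Expr} {F : (State → Prop) → State → Prop}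
    (hF : ∀ Q Q' s, F Q s → (∀ s', Q s' → Q' s') → F Q' s) (Inv : ℕ → State → Prop)
    (hdone : ∀ k s, Inv k s → e.val s = 0 → Q s)
    (hstep : ∀ k s, Inv k s → e.val s ≠ 0 → F (fun s' => ∃ k' < k, Inv k' s') s) {r k : ℕ}
    (hk : k < r) (h : Inv k s) : wpLoop e F r Q s := by
  induction r generalizing k s with
  | zero => exact absurd hk (Nat.not_lt_zero k)
  | succ r ih =>
    by_cases he : e.val s = 0
    · exact .inl ⟨he, hdone k s h he⟩
    · exact .inr ⟨he, hF _ _ _ (hstep k s h he) fun s' ⟨k', hk', h'⟩ => ih (by omega) h'⟩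

theorem wp_loop {k : ℕ} {e : Expr} {c : Program} (Inv : ℕ → State → Prop) (hk : k < R)
    (h : Inv k s) (hdone : ∀ k s', c.Frame s s' → Inv k s' → e.val s' = 0 → Q s')
    (hstep : ∀ k s', c.Frame s s' → Inv k s' → e.val s' ≠ 0 →
      wp R c (fun s'' => ∃ k' < k, Inv k' s'') s') :
    wp R (.loop e c) Q s := by
  refine wpLoop_of_invariant (F := wp R c) (fun _ _ _ => wp_mono)
    (fun k s' => Inv k s' ∧ c.Frame s s') (fun k s' h => hdone k s' h.2 h.1)
    (fun k s₁ h he => ?_) hk ⟨h, .refl c s⟩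
  exact wp_mono (wp_frame (hstep k s₁ h.2 h.1 he)) fun s₂ ⟨⟨k', hk', h₂⟩, f₂⟩ =>
    ⟨k', hk', h₂, h.2.trans f₂⟩

/-! ### Variables, matrices and `for` loops -/

/-- The address of the entry `(u, v)` of a matrix.  The map `(u, v) ↦ (u + v) ^ 2 + u` is injective,
so the addresses do not depend on the size of the matrix. -/
def address (u v : ℕ) : ℕ := (u + v) * (u + v) + u

theorem address_inj {u v u' v' : ℕ} : address u v = address u' v' ↔ u = u' ∧ v = v' := by
  refine ⟨fun h => ?_, by rintro ⟨rfl, rfl⟩; rfl⟩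
  unfold address at h
  have hs : u + v = u' + v' := by
    rcases lt_trichotomy (u + v) (u' + v') with hlt | heq | hlt
    · nlinarith
    · exact heq
    · nlinarith
  rw [hs] at h
  omega

/-- The array with name `a` as a matrix. -/
def State.mat (s : State) (a : ℕ) : ℕ → ℕ → ℕ := fun u v => s a (address u v)

namespace Expr

/-- The variable `a`, stored in the cell `0` of the array `a`. -/
def var (a : ℕ) : Expr := get a 0

/-- The address of an entry of a matrix. -/
def address (u v : Expr) : Expr := (u + v) * (u + v) + u

/-- The entry `(u, v)` of the matrix `a`. -/
def entry (a : ℕ) (u v : Expr) : Expr := get a (address u v)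

/-- The test whether `e₂ ≤ e₁`. -/
def ge (e₁ e₂ : Expr) : Expr := e₁ + 1 - e₂

end Expr

namespace Program

/-- Assignment to a variable. -/
def setVar (a : ℕ) (e : Expr) : Program := assign a 0 e

/-- Assignment to an entry of a matrix. -/
def setEntry (a : ℕ) (u v e : Expr) : Program := assign a (.address u v) e

end Program

open RAM.Expr RAM.Program

local infixr:60 ";;" => Program.seq
local infix:62 "::=" => Program.setVar

section Val

variable (s : State) (a k : ℕ) (e e₁ e₂ : Expr)

@[simp] theorem val_ofNat : (no_index (OfNat.ofNat k) : Expr).val s = OfNat.ofNat k := rfl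
@[simp] theorem val_get : (get a e).val s = s a (e.val s) := rfl
@[simp] theorem val_add : (e₁ + e₂).val s = e₁.val s + e₂.val s := rfl
@[simp] theorem val_sub : (e₁ - e₂).val s = e₁.val s - e₂.val s := rfl
@[simp] theorem val_mul : (e₁ * e₂).val s = e₁.val s * e₂.val s := rfl
@[simp] theorem val_div : (e₁ / e₂).val s = e₁.val s / e₂.val s := rfl
@[simp] theorem val_var : (var a).val s = s a 0 := rfl
@[simp] theorem val_entry : (entry a e₁ e₂).val s = s.mat a (e₁.val s) (e₂.val s) := rfl

theorem val_ge_ne_zero : (ge e₁ e₂).val s ≠ 0 ↔ e₂.val s ≤ e₁.val s := by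
  simp only [ge, val_sub, val_add, val_ofNat]; omega

theorem val_ge_eq_zero : (ge e₁ e₂).val s = 0 ↔ e₁.val s < e₂.val s := by
  simp only [ge, val_sub, val_add, val_ofNat]; omega

end Val

section Mat

theorem State.mat_set_same (s : State) (a u v x : ℕ) : (s.set a (address u v) x).mat a =
    fun u' v' => if u' = u ∧ v' = v then x else s.mat a u' v' := by
  funext u' v'
  simp only [mat, set_apply, true_and, address_inj]

theorem State.mat_congr {a : ℕ} (h : s' a = s a) : s'.mat a = s.mat a := by
  unfold mat; rw [h]

theorem State.mat_set_of_ne (s : State) {a b : ℕ} (i x : ℕ) (h : b ≠ a) :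
    (s.set a i x).mat b = s.mat b :=
  mat_congr (set_of_ne _ _ _ h)

theorem Program.Frame.mat {c : Program} (h : c.Frame s s') (a : ℕ)
    (ha : c.writes a = false := by decide) : s'.mat a = s.mat a :=
  State.mat_congr (h a ha)

end Mat

section Rules

variable {c₁ c₂ : Program} {a : ℕ} {e e₁ e₂ i : Expr}

@[simp] theorem wp_skip : wp R .skip Q s ↔ Q s := Iff.rfl

@[simp] theorem wp_assign : wp R (.assign a i e) Q s ↔ Q (s.set a (i.val s) (e.val s)) := Iff.rfl

@[simp] theorem wp_setVar : wp R (a ::= e) Q s ↔ Q (s.set a 0 (e.val s)) := Iff.rfl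

@[simp] theorem wp_setEntry : wp R (setEntry a e₁ e₂ e) Q s ↔
    Q (s.set a (RAM.address (e₁.val s) (e₂.val s)) (e.val s)) := Iff.rfl

theorem wp_seq : wp R (c₁ ;; c₂) Q s ↔ wp R c₁ (wp R c₂ Q) s := Iff.rfl

theorem wp_ite : wp R (.ite e c₁ c₂) Q s ↔
    (e.val s ≠ 0 → wp R c₁ Q s) ∧ (e.val s = 0 → wp R c₂ Q s) := Iff.rfl

end Rules

/-- `for i < v do c`, where `i` and `v` are variables. -/
def Program.forTo (i v : ℕ) (c : Program) : Program :=
  i ::= 0 ;; .loop (var v - var i) (c ;; i ::= var i + 1)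

theorem writes_forTo {i v a : ℕ} {c : Program} :
    (forTo i v c).writes a = false ↔ a ≠ i ∧ c.writes a = false := by
  simp only [forTo, setVar, writes, Bool.or_eq_false_iff, beq_eq_false_iff_ne]
  tauto

theorem wp_forTo {m i v : ℕ} {c : Program} (Inv : ℕ → State → Prop) (hm : s v 0 = m) (hmR : m < R)
    (hInv : ∀ j s₁ s₂, (∀ a, a ≠ i → s₂ a = s₁ a) → Inv j s₁ → Inv j s₂) (h : Inv 0 s)
    (hstep : ∀ j < m, ∀ s₁, (forTo i v c).Frame s s₁ → s₁ i 0 = j → Inv j s₁ →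
      wp R c (Inv (j + 1)) s₁)
    (hdone : ∀ s₁, (forTo i v c).Frame s s₁ → Inv m s₁ → Q s₁)
    (hv : (forTo i v c).writes v = false := by decide) (hi : c.writes i = false := by decide) :
    wp R (forTo i v c) Q s := by
  have hframe : ∀ {s₁}, (c ;; i ::= var i + 1).Frame (s.set i 0 0) s₁ →
      (forTo i v c).Frame s s₁ := by
    intro s₁ f a ha
    obtain ⟨hai, hac⟩ := writes_forTo.1 ha
    rw [f a (by simp [writes, setVar, hac, hai]), State.set_of_ne _ _ _ hai]
  have hval : ∀ {s₁ j}, (forTo i v c).Frame s s₁ → s₁ i 0 = j →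
      (var v - var i).val s₁ = m - j := fun f hij => by simp [hij, f.var v hv, hm]
  refine wp_loop (fun k s' => ∃ j, j + k = m ∧ s' i 0 = j ∧ Inv j s') hmR
    ⟨0, m.zero_add, by simp [State.set_apply], hInv 0 s _ (fun a => State.set_of_ne _ _ _) h⟩ ?_ ?_
  · rintro k s₁ f ⟨j, hjk, hij, hI⟩ he
    rw [hval (hframe f) hij] at he
    obtain rfl : j = m := by omega
    exact hdone s₁ (hframe f) hI
  · rintro k s₁ f ⟨j, hjk, hij, hI⟩ he
    rw [hval (hframe f) hij] at he
    refine wp_seq_frame (hstep j (by omega) s₁ (hframe f) hij hI) fun s₂ f₂ hI₂ => ?_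
    exact ⟨k - 1, by omega, j + 1, by omega, by simp [State.set_apply, f₂.var i hi, hij],
      hInv _ s₂ _ (fun a => State.set_of_ne _ _ _) hI₂⟩

/-- `for i < v do for j < v do c`, where `i`, `j` and `v` are variables. -/
def Program.forPairs (i j v : ℕ) (c : Program) : Program := forTo i v (forTo j v c)

theorem wp_forPairs {m i j v : ℕ} {c : Program} (Inv : ℕ → ℕ → State → Prop) (hm : s v 0 = m)
    (hmR : m < R)
    (hInv : ∀ k l s₁ s₂, (∀ a, a ≠ i → a ≠ j → s₂ a = s₁ a) → Inv k l s₁ → Inv k l s₂)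
    (h : Inv 0 0 s) (hrow : ∀ k s, Inv k m s → Inv (k + 1) 0 s)
    (hstep : ∀ k < m, ∀ l < m, ∀ s₁, (forPairs i j v c).Frame s s₁ → s₁ i 0 = k → s₁ j 0 = l →
      Inv k l s₁ → wp R c (Inv k (l + 1)) s₁)
    (hdone : ∀ s₁, (forPairs i j v c).Frame s s₁ → Inv m 0 s₁ → Q s₁)
    (hv : (forPairs i j v c).writes v = false := by decide)
    (hi : (forTo j v c).writes i = false := by decide) (hj : c.writes j = false := by decide) :
    wp R (forPairs i j v c) Q s := by
  refine wp_forTo (fun k => Inv k 0) hm hmR (fun k s₁ s₂ h => hInv k 0 s₁ s₂ fun a ha _ => h a ha) h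
    (fun k hk s₁ f₁ hk₁ hI => ?_) hdone hv hi
  refine wp_forTo (Inv k) ((f₁.var v hv).trans hm) hmR
    (fun l s₁ s₂ h => hInv k l s₁ s₂ fun a _ ha => h a ha) hI (fun l hl s₂ f₂ hl₂ hJ => ?_)
    (fun s₂ _ => hrow k s₂) (writes_forTo.1 hv).2 hj
  exact hstep k hk l hl s₂ (f₁.trans (f₂.mono fun a ha => (writes_forTo.1 ha).2))
    ((f₂.var i hi).trans hk₁) hl₂ hJ

/-- `Inv S` is the invariant when the pairs in `S` have been treated. -/
theorem wp_forPairs_of_set {m i j v : ℕ} {c : Program} (Inv : Set (ℕ × ℕ) → State → Prop)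
    (hm : s v 0 = m) (hmR : m < R)
    (hInv : ∀ S s₁ s₂, (∀ a, a ≠ i → a ≠ j → s₂ a = s₁ a) → Inv S s₁ → Inv S s₂) (h : Inv ∅ s)
    (hstep : ∀ S, ∀ k < m, ∀ l < m, ∀ s₁, (forPairs i j v c).Frame s s₁ → s₁ i 0 = k →
      s₁ j 0 = l → Inv S s₁ → wp R c (Inv (insert (k, l) S)) s₁)
    (hdone : ∀ s₁, (forPairs i j v c).Frame s s₁ → Inv (Set.Iio m ×ˢ Set.Iio m) s₁ → Q s₁)
    (hv : (forPairs i j v c).writes v = false := by decide)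
    (hi : (forTo j v c).writes i = false := by decide) (hj : c.writes j = false := by decide) :
    wp R (forPairs i j v c) Q s := by
  have hrow (k : ℕ) : {p : ℕ × ℕ | p.2 < m ∧ (p.1 < k + 1 ∨ p.1 = k + 1 ∧ p.2 < 0)} =
      {p | p.2 < m ∧ (p.1 < k ∨ p.1 = k ∧ p.2 < m)} := by
    ext; simp only [Set.mem_ofPred_eq]; omega
  have hinsert {k l : ℕ} (hl : l < m) :
      {p : ℕ × ℕ | p.2 < m ∧ (p.1 < k ∨ p.1 = k ∧ p.2 < l + 1)} =
      insert (k, l) {p | p.2 < m ∧ (p.1 < k ∨ p.1 = k ∧ p.2 < l)} := by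
    ext; simp only [Set.mem_ofPred_eq, Set.mem_insert_iff, Prod.ext_iff]; omega
  have hall : {p : ℕ × ℕ | p.2 < m ∧ (p.1 < m ∨ p.1 = m ∧ p.2 < 0)} =
      Set.Iio m ×ˢ Set.Iio m := by
    ext; simp only [Set.mem_ofPred_eq, Set.mem_prod, Set.mem_Iio]; omega
  refine wp_forPairs (fun k l => Inv {p | p.2 < m ∧ (p.1 < k ∨ p.1 = k ∧ p.2 < l)}) hm hmR
    (fun k l => hInv _) (by simpa using h) (fun k s₁ h₁ => (hrow k).symm ▸ h₁)
    (fun k hk l hl s₁ f₁ hk₁ hl₁ h₁ => ?_) (fun s₁ f₁ h₁ => hdone s₁ f₁ (hall ▸ h₁)) hv hi hj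
  rw [hinsert hl]
  exact hstep _ k hk l hl s₁ f₁ hk₁ hl₁ h₁

/-! ### The transshipment algorithm as a program -/

open Transship

namespace Reg

abbrev input : ℕ := 0
abbrev output : ℕ := 1
abbrev vertices : ℕ := 2
abbrev nodes : ℕ := 3
abbrev bigCost : ℕ := 4
abbrev denominator : ℕ := 5
abbrev costBound : ℕ := 6
abbrev cost : ℕ := 7
abbrev supply : ℕ := 8
abbrev demand : ℕ := 9
abbrev flow : ℕ := 10
abbrev potential : ℕ := 11
abbrev marked : ℕ := 12
abbrev parent : ℕ := 13
abbrev scale : ℕ := 14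
abbrev source : ℕ := 15
abbrev sink : ℕ := 16
abbrev row : ℕ := 17
abbrev col : ℕ := 18
abbrev minCost : ℕ := 19
abbrev minTail : ℕ := 20
abbrev minHead : ℕ := 21
abbrev found : ℕ := 22
abbrev pairCost : ℕ := 23
abbrev head : ℕ := 24
abbrev tail : ℕ := 25
abbrev totalDemand : ℕ := 26
abbrev totalSupply : ℕ := 27
abbrev infeasible : ℕ := 28

end Reg

/-- The value `d = r u v` is minimal among the pairs in `S`, or `S` is empty and `found = 0`. -/
structure IsArgmin (S : ℕ → ℕ → Prop) (r : ℕ → ℕ → ℕ) (found d u v : ℕ) : Prop where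
  empty : found = 0 → ∀ a b, ¬S a b
  mem : found ≠ 0 → S u v
  eq : found ≠ 0 → d = r u v
  le : found ≠ 0 → ∀ a b, S a b → d ≤ r a b

section IsArgmin

variable {S S' : ℕ → ℕ → Prop} {r : ℕ → ℕ → ℕ} {found d u v i j : ℕ}

theorem IsArgmin.congr (h : IsArgmin S r found d u v) (hS : ∀ a b, S' a b ↔ S a b) :
    IsArgmin S' r found d u v := by
  obtain rfl : S' = S := by funext a b; exact propext (hS a b)
  exact h

theorem IsArgmin.keep (h : IsArgmin S r found d u v) (hf : found ≠ 0) (hd : d ≤ r i j) :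
    IsArgmin (fun a b => S a b ∨ a = i ∧ b = j) r found d u v where
  empty h₀ := absurd h₀ hf
  mem _ := .inl (h.mem hf)
  eq := h.eq
  le _ := by
    rintro a b (hab | ⟨rfl, rfl⟩)
    · exact h.le hf a b hab
    · exact hd

theorem IsArgmin.replace (h : IsArgmin S r found d u v) (hd : found = 0 ∨ r i j < d) :
    IsArgmin (fun a b => S a b ∨ a = i ∧ b = j) r 1 (r i j) i j where
  empty h₀ := absurd h₀ one_ne_zero
  mem _ := .inr ⟨rfl, rfl⟩
  eq _ := rfl
  le _ := by
    rintro a b (hab | ⟨rfl, rfl⟩)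
    · rcases eq_or_ne found 0 with h₀ | h₀
      · exact absurd hab (h.empty h₀ a b)
      · exact (hd.resolve_left h₀).le.trans (h.le h₀ a b hab)
    · exact le_rfl

end IsArgmin

/-- The reduced costs for the costs, the flow and the potential stored in a state. -/
def State.reducedCost (s : State) : ℕ → ℕ → ℕ :=
  Transship.reducedCost (s.mat Reg.cost) (s.mat Reg.flow) (s Reg.potential)

/-- The registers of the search for a pair hold a pair in `S` of minimum reduced cost `r`. -/
def State.IsMinPair (s : State) (S : ℕ → ℕ → Prop) (r : ℕ → ℕ → ℕ) : Prop :=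
  IsArgmin S r (s Reg.found 0) (s Reg.minCost 0) (s Reg.minTail 0) (s Reg.minHead 0)

/-- Compute the reduced cost of the pair `(row, col)`. -/
def computePairCost : Program :=
  .ite (entry Reg.flow (var Reg.col) (var Reg.row)) (Reg.pairCost ::= 0)
    (Reg.pairCost ::= entry Reg.cost (var Reg.row) (var Reg.col) +
      get Reg.potential (var Reg.row) - get Reg.potential (var Reg.col))

/-- Compare the pair `(row, col)` with the best pair so far. -/
def comparePair : Program :=
  computePairCost ;;
  .ite (var Reg.found * ge (var Reg.pairCost) (var Reg.minCost)) .skip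
    (Reg.minCost ::= var Reg.pairCost ;; Reg.minTail ::= var Reg.row ;;
      Reg.minHead ::= var Reg.col ;; Reg.found ::= 1)

/-- Find the pair with least reduced cost from a marked to an unmarked node. -/
def findPair : Program :=
  Reg.found ::= 0 ;;
  forPairs Reg.row Reg.col Reg.nodes
    (.ite (get Reg.marked (var Reg.row))
      (.ite (get Reg.marked (var Reg.col)) .skip comparePair) .skip)

section FindPair

variable {R N : ℕ} {s : State}

theorem wp_computePairCost :
    wp R computePairCost (fun s' => s' Reg.pairCost 0 = s.reducedCost (s Reg.row 0) (s Reg.col 0))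
      s := by
  simp only [computePairCost, wp_ite, wp_setVar, State.set_same, val_entry, val_var]
  constructor <;> intro h <;> simp [State.reducedCost, Transship.reducedCost, h]

theorem wp_comparePair {S : ℕ → ℕ → Prop} (h : s.IsMinPair S s.reducedCost) :
    wp R comparePair (fun s' => s'.IsMinPair
      (fun a b => S a b ∨ a = s Reg.row 0 ∧ b = s Reg.col 0) s.reducedCost) s := by
  refine wp_seq_frame wp_computePairCost fun s₁ f₁ hr => ?_
  simp only [wp_ite, val_mul, val_var, mul_ne_zero_iff, val_ge_ne_zero, mul_eq_zero,
    val_ge_eq_zero, hr, f₁.array Reg.found, f₁.array Reg.minCost]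
  constructor <;> intro hcmp
  · simpa +decide only [wp_skip, State.IsMinPair, f₁ _] using h.keep hcmp.1 hcmp.2
  · simpa [wp_seq, State.IsMinPair, State.set_apply, hr, f₁.array Reg.row, f₁.array Reg.col]
      using h.replace hcmp

theorem wp_findPair (hN : s Reg.nodes 0 = N) (hR : N < R) :
    wp R findPair (fun s' => s'.IsMinPair (fun a b => (a < N ∧ b < N) ∧
      s Reg.marked a ≠ 0 ∧ s Reg.marked b = 0) s.reducedCost) s := by
  rw [findPair, wp_seq, wp_setVar]
  refine wp_forPairs_of_set
    (fun S s' => s'.IsMinPair (fun a b => (a, b) ∈ S ∧ s Reg.marked a ≠ 0 ∧ s Reg.marked b = 0)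
      s.reducedCost)
    (by simpa [State.set_apply] using hN) hR
    (fun S s₁ s₂ h h₁ => by simpa [State.IsMinPair, h] using h₁) ?_
    (fun S k _ l _ s₁ f₁ hk hl h => ?_) (fun s₁ _ h => h)
  · constructor <;> simp [State.set_apply]
  · have h_marked : s₁ Reg.marked = s Reg.marked := by
      rw [f₁.array Reg.marked, State.set_of_ne _ _ _ (by decide)]
    have h_cost : s₁.reducedCost = s.reducedCost := by
      simp only [State.reducedCost, f₁.mat Reg.cost, f₁.mat Reg.flow, f₁.array Reg.potential]
      rfl
    simp only [wp_ite, wp_skip, val_get, val_var, hk, hl, h_marked]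
    refine ⟨fun hk₀ => ⟨fun hl₀ => h.congr fun a b => ?_, fun hl₀ => ?_⟩,
      fun hk₀ => h.congr fun a b => ?_⟩
    · grind
    · have := wp_comparePair (R := R) (s := s₁) (by rwa [h_cost])
      rw [h_cost, hk, hl] at this
      refine wp_mono this fun s' h' => h'.congr fun a b => ?_
      grind
    · grind

end FindPair

/-- Add `minCost` to the potential of all unmarked nodes. -/
def raise : Program :=
  forTo Reg.row Reg.nodes (.ite (get Reg.marked (var Reg.row)) .skip
    (.assign Reg.potential (var Reg.row) (get Reg.potential (var Reg.row) + var Reg.minCost)))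

/-- Mark one more node. -/
def searchStep : Program :=
  findPair ;; raise ;; .assign Reg.marked (var Reg.minHead) 1 ;;
  .assign Reg.parent (var Reg.minHead) (var Reg.minTail)

/-- Unmark all nodes except `source`. -/
def markSource : Program :=
  forTo Reg.row Reg.nodes (.assign Reg.marked (var Reg.row) 0) ;;
  .assign Reg.marked (var Reg.source) 1

/-- Dijkstra's algorithm: grow a tree of residual arcs of reduced cost zero from `source` until it
contains `sink`, raising the potential of the other nodes. -/
def search : Program :=
  markSource ;; .loop (1 - get Reg.marked (var Reg.sink)) searchStep

/-- The stored potential certifies the optimality of the stored flow. -/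
def State.IsCertified (N : ℕ) (s : State) : Prop :=
  IsCertificate N (s.mat Reg.cost) (s.mat Reg.flow) (s Reg.potential)

/-- The stored nodes and parents form a tree of tight arcs with root `source`. -/
def State.HasTightTree (N : ℕ) (rk : ℕ → ℕ) (s : State) : Prop :=
  TightTree N (s.mat Reg.cost) (s.mat Reg.flow) (s Reg.potential) (s Reg.marked) (s Reg.parent) rk
    (s Reg.source 0)

section Search

variable {R N : ℕ} {s : State}

theorem wp_raise (hN : s Reg.nodes 0 = N) (hR : N < R) :
    wp R raise (fun s' => ∀ w < N, s' Reg.potential w =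
      if s Reg.marked w = 0 then s Reg.potential w + s Reg.minCost 0 else s Reg.potential w) s := by
  refine wp_forTo (fun j s' => ∀ w, s' Reg.potential w = if w < j ∧ s Reg.marked w = 0
    then s Reg.potential w + s Reg.minCost 0 else s Reg.potential w) hN hR
    (fun j s₁ s₂ h h₁ => by simpa [h] using h₁) (by simp) (fun j _ s₁ f₁ hj h => ?_)
    (fun s₁ _ h w hw => by simp [h, hw])
  simp only [wp_ite, wp_skip, wp_assign, val_get, val_var, val_add, hj, f₁.array Reg.marked,
    f₁.array Reg.minCost, State.set_apply, true_and]
  refine ⟨fun hm w => ?_, fun hm w => ?_⟩ <;> rcases lt_trichotomy w j with hw | rfl | hw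
  · simp [h, hw, hw.trans (Nat.lt_succ_self j)]
  · simp [h, hm]
  · simp [h, hw.not_gt, (Nat.succ_le_of_lt hw).not_gt]
  · simp [h, hw, hw.ne, hw.trans (Nat.lt_succ_self j)]
  · simp [h, hm]
  · simp [h, hw.not_gt, hw.ne', (Nat.succ_le_of_lt hw).not_gt]

theorem wp_searchStep {rk : ℕ → ℕ} {t : ℕ} (hN : s Reg.nodes 0 = N) (hR : N < R)
    (hc : s.IsCertified N) (hT : s.HasTightTree N rk) (hs : s Reg.source 0 < N) (ht : t < N)
    (hAt : s Reg.marked t = 0) :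
    wp R searchStep (fun s' => s'.IsCertified N ∧ (∃ rk', s'.HasTightTree N rk') ∧
      unmarkedCount N (s' Reg.marked) < unmarkedCount N (s Reg.marked)) s := by
  refine wp_seq_frame (wp_findPair hN hR) fun s₁ f₁ hmin => ?_
  refine wp_seq_frame (wp_raise ((f₁.var Reg.nodes).trans hN) hR) fun s₂ f₂ hr => ?_
  have hfound : s₁ Reg.found 0 ≠ 0 := fun h₀ =>
    hmin.empty h₀ (s Reg.source 0) t ⟨⟨hs, ht⟩, hT.root, hAt⟩
  obtain ⟨⟨hu, hv⟩, hAu, hAv⟩ := hmin.mem hfound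
  rw [f₁.array Reg.marked, f₁.array Reg.potential, hmin.eq hfound] at hr
  have hcert := hc.raise (δ := s.reducedCost (s₁ Reg.minTail 0) (s₁ Reg.minHead 0))
    fun a ha b hb hAa hAb => (hmin.eq hfound).ge.trans
      (hmin.le hfound a b ⟨⟨ha, hb⟩, hAa, hAb⟩)
  have htree := hT.extend hc hu hv hAu hAv
  simp +decide only [wp_seq, wp_assign, val_var, val_ofNat, State.IsCertified, State.HasTightTree,
    State.mat_set_of_ne, State.set_of_ne, State.set_same, ne_eq, f₂.mat Reg.cost, f₁.mat Reg.cost,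
    f₂.mat Reg.flow, f₁.mat Reg.flow, f₂ _, f₁ _]
  exact ⟨hcert.congr hr, ⟨_, htree.congr hr⟩, Nat.lt_of_succ_le (unmarkedCount_update hv hAv).le⟩

theorem wp_markSource (hN : s Reg.nodes 0 = N) (hR : N < R) :
    wp R markSource (fun s' => s' Reg.marked (s Reg.source 0) ≠ 0 ∧
      ∀ v < N, s' Reg.marked v ≠ 0 → v = s Reg.source 0) s := by
  refine wp_seq_frame (Q₁ := fun s' => ∀ v < N, s' Reg.marked v = 0)
    (wp_forTo (fun j s' => ∀ v < j, s' Reg.marked v = 0) hN hR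
      (fun j s₁ s₂ h h₁ => by simpa [h] using h₁) (by simp) (fun j _ s₁ _ hj h => ?_)
      (fun s₁ _ h => h)) fun s₁ f₁ h => ?_
  · simp only [wp_assign, val_var, hj, val_ofNat, State.set_apply, true_and]
    intro v hv
    split_ifs with hvj
    · rfl
    · exact h v (by omega)
  · simp only [wp_assign, val_var, val_ofNat, f₁.array Reg.source, State.set_apply, true_and,
      if_true]
    refine ⟨one_ne_zero, fun v hv hv₁ => ?_⟩
    by_contra hne
    rw [if_neg hne] at hv₁
    exact hv₁ (h v hv)

theorem wp_search (hN : s Reg.nodes 0 = N) (hR : N < R) (hc : s.IsCertified N)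
    (hs : s Reg.source 0 < N) (ht : s Reg.sink 0 < N) :
    wp R search (fun s' => s' Reg.marked (s Reg.sink 0) ≠ 0 ∧ s'.IsCertified N ∧
      ∃ rk, s'.HasTightTree N rk) s := by
  refine wp_seq_frame (wp_markSource hN hR) fun s₁ f₁ ⟨hA, hroot⟩ => ?_
  refine wp_loop (k := N) (fun k s' => s'.IsCertified N ∧ (∃ rk, s'.HasTightTree N rk) ∧
    unmarkedCount N (s' Reg.marked) ≤ k) hR
    ⟨?_, ⟨fun _ => 0, ?_⟩, unmarkedCount_le _ _⟩ ?_ ?_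
  · simpa +decide only [State.IsCertified, f₁.mat Reg.cost, f₁.mat Reg.flow, f₁ _] using hc
  · rw [← f₁.array Reg.source] at hA hroot
    exact tightTree_of_forall_eq_root hA hroot
  · rintro k s₂ f₂ ⟨hc₂, hT₂, -⟩ hmarked
    simp only [val_sub, val_get, val_var, val_ofNat, f₂.array Reg.sink, f₁.array Reg.sink]
      at hmarked
    exact ⟨by omega, hc₂, hT₂⟩
  · rintro k s₂ f₂ ⟨hc₂, ⟨rk, hT₂⟩, hk⟩ hmarked
    simp only [val_sub, val_get, val_var, val_ofNat, f₂.array Reg.sink, f₁.array Reg.sink]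
      at hmarked
    refine wp_mono (wp_searchStep ((f₂.var Reg.nodes).trans ((f₁.var Reg.nodes).trans hN)) hR hc₂
      hT₂ ?_ ht (by omega)) fun s₃ h => ?_
    · rwa [f₂.array Reg.source, f₁.array Reg.source]
    · exact ⟨_, h.2.2.trans_le hk, h.1, h.2.1, le_rfl⟩

end Search

/-- Send `scale` units along the residual arc `(tail, head)`. -/
def pushArc : Program :=
  .ite (entry Reg.flow (var Reg.head) (var Reg.tail))
    (setEntry Reg.flow (var Reg.head) (var Reg.tail)
      (entry Reg.flow (var Reg.head) (var Reg.tail) - var Reg.scale))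
    (setEntry Reg.flow (var Reg.tail) (var Reg.head)
      (entry Reg.flow (var Reg.tail) (var Reg.head) + var Reg.scale))

/-- Send `scale` units from `source` to `sink` in the tree. -/
def walk : Program :=
  Reg.head ::= var Reg.sink ;;
  .loop (var Reg.head - var Reg.source + (var Reg.source - var Reg.head))
    (Reg.tail ::= get Reg.parent (var Reg.head) ;; pushArc ;; Reg.head ::= var Reg.tail)

/-- Send `scale` units from `source` to `sink` along a shortest path of the residual network. -/
def augment : Program :=
  search ;; walk ;;
  .assign Reg.supply (var Reg.source) (get Reg.supply (var Reg.source) - var Reg.scale) ;;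
  .assign Reg.demand (var Reg.sink) (get Reg.demand (var Reg.sink) - var Reg.scale)

/-- The stored flow is balanced and certified for the supplies `P` and demands `Q`, up to the stored
remaining supplies and demands, which have the same total. -/
structure State.IsPartialFlow (N : ℕ) (P Q : ℕ → ℕ) (s : State) : Prop where
  certified : s.IsCertified N
  balanced : Balanced N (s.mat Reg.flow) (P + s Reg.demand) (Q + s Reg.supply)
  sum_eq : ∑ v ∈ Finset.range N, s Reg.supply v = ∑ v ∈ Finset.range N, s Reg.demand v

section Augment

variable {R N : ℕ} {s : State} {P Q : ℕ → ℕ}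

theorem wp_pushArc : wp R pushArc (fun s' => s'.mat Reg.flow =
    push (s.mat Reg.flow) (s Reg.scale 0) (s Reg.tail 0) (s Reg.head 0)) s := by
  simp only [pushArc, wp_ite, wp_setEntry, val_entry, val_var, val_sub, val_add,
    State.mat_set_same]
  constructor <;> intro h <;> funext a b
  · simp only [push, if_pos h]
    split_ifs with hab
    · rw [hab.1, hab.2]
    · rfl
  · simp only [push, h, ne_eq, not_true_eq_false, if_false]
    split_ifs with hab
    · rw [hab.1, hab.2]
    · rfl

theorem wp_walk {rk : ℕ → ℕ} (hR : N < R) (hc : s.IsCertified N) (hT : s.HasTightTree N rk)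
    (ht : s Reg.sink 0 < N) (hAt : s Reg.marked (s Reg.sink 0) ≠ 0)
    (hd : ∀ a b, s Reg.scale 0 ∣ s.mat Reg.flow a b) (hb : Balanced N (s.mat Reg.flow) P Q) :
    wp R walk (fun s' => IsPartialAugmentation N (s.mat Reg.cost) (s Reg.potential) (s Reg.marked)
      (s Reg.parent) rk P Q (s Reg.source 0) (s Reg.sink 0) (s Reg.scale 0) (s'.mat Reg.flow)
      (s Reg.source 0)) s := by
  refine wp_seq_frame (Q₁ := fun s₁ => s₁ Reg.head 0 = s Reg.sink 0)
    (by simp [State.set_apply]) fun s₁ f₁ h_head => ?_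
  refine wp_loop (k := rk (s Reg.sink 0)) (fun k s' => rk (s' Reg.head 0) = k ∧
    IsPartialAugmentation N (s.mat Reg.cost) (s Reg.potential) (s Reg.marked) (s Reg.parent) rk P Q
      (s Reg.source 0) (s Reg.sink 0) (s Reg.scale 0) (s'.mat Reg.flow) (s' Reg.head 0)) ?_
    ⟨by rw [h_head], ?_⟩ ?_ ?_
  · have := hT.rk_le _ ht hAt
    omega
  · rw [h_head, f₁.mat Reg.flow]
    exact hT.isPartialAugmentation hc ht hAt hd hb
  · rintro k s₂ f₂ ⟨-, h⟩ hloop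
    simp only [val_add, val_sub, val_var, f₂.array Reg.source, f₁.array Reg.source] at hloop
    rwa [show s₂ Reg.head 0 = s Reg.source 0 by omega] at h
  · rintro k s₂ f₂ ⟨rfl, h⟩ hloop
    simp only [val_add, val_sub, val_var, f₂.array Reg.source, f₁.array Reg.source] at hloop
    have hne : s₂ Reg.head 0 ≠ s Reg.source 0 := by omega
    rw [wp_seq, wp_setVar]
    refine wp_seq_frame wp_pushArc fun s₃ f₃ h₃ => ?_
    simp +decide only [val_get, val_var, State.mat_set_of_ne, State.set_apply, if_true,
      if_false, f₂ _, f₁ _] at h₃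
    simp +decide only [wp_setVar, val_var, State.mat_set_of_ne, State.set_apply, if_true, f₃ _,
      f₂ _, f₁ _, h₃, val_get]
    exact ⟨_, hT.rk_lt _ h.lt h.marked hne, rfl, h.step hT hne⟩

theorem sum_update_sub {a d : ℕ} {f : ℕ → ℕ} (ha : a < N) (hd : d ≤ f a) :
    ∑ v ∈ Finset.range N, Function.update f a (f a - d) v + d = ∑ v ∈ Finset.range N, f v := by
  have ha' := Finset.mem_range.2 ha
  rw [Finset.sum_update_of_mem ha', ← Finset.add_sum_erase _ _ ha', Finset.sdiff_singleton_eq_erase]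
  omega

theorem update_sub_add_single {a d : ℕ} {f : ℕ → ℕ} (hd : d ≤ f a) :
    Function.update f a (f a - d) + Pi.single a d = f := by
  funext w
  rcases eq_or_ne w a with rfl | h
  · simp [hd]
  · simp [h]

theorem wp_augment (hN : s Reg.nodes 0 = N) (hR : N < R) (h : s.IsPartialFlow N P Q)
    (hd : ∀ a b, s Reg.scale 0 ∣ s.mat Reg.flow a b) (hs : s Reg.source 0 < N)
    (ht : s Reg.sink 0 < N) (hp : s Reg.scale 0 ≤ s Reg.supply (s Reg.source 0))
    (hq : s Reg.scale 0 ≤ s Reg.demand (s Reg.sink 0)) :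
    wp R augment (fun s' => s'.IsPartialFlow N P Q ∧
      (∀ a b, s Reg.scale 0 ∣ s'.mat Reg.flow a b) ∧
      ∑ v ∈ Finset.range N, s' Reg.supply v + s Reg.scale 0 =
        ∑ v ∈ Finset.range N, s Reg.supply v) s := by
  refine wp_seq_frame (wp_search hN hR h.certified hs ht) fun s₁ f₁ ⟨hA, hc, rk, hT⟩ => ?_
  have h_flow := f₁.mat Reg.flow
  refine wp_seq_frame (wp_walk hR hc hT (P := P + s Reg.demand) (Q := Q + s Reg.supply) ?_ ?_ ?_ ?_)
    fun s₂ f₂ hw => ?_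
  · rwa [f₁.array Reg.sink]
  · rwa [f₁.array Reg.sink]
  · rwa [f₁.array Reg.scale, h_flow]
  · rw [h_flow]
    exact h.balanced
  have h_sum := sum_update_sub hs hp
  have h_sum' := sum_update_sub ht hq
  have h_supply := update_sub_add_single hp
  have h_demand := update_sub_add_single hq
  obtain ⟨-, -, hcert, hdvd, -, hb⟩ := hw
  simp +decide only [f₁ _] at hdvd hb
  rw [← f₂.mat Reg.cost, ← f₂.array Reg.potential] at hcert
  simp +decide only [wp_seq, wp_assign, val_sub, val_get, val_var, State.set_of_ne,
    State.set_same, State.mat_set_of_ne, ne_eq, f₂ _, f₁ _]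
  refine ⟨⟨?_, ?_, ?_⟩, hdvd, h_sum⟩
  · simpa +decide only [State.IsCertified, State.mat_set_of_ne, State.set_of_ne, ne_eq]
      using hcert
  · simp +decide only [State.mat_set_of_ne, State.set_of_ne, State.set_same, ne_eq, f₂ _, f₁ _]
    rw [← h_supply, ← h_demand] at hb
    intro w hw
    have := hb w hw
    simp only [Pi.add_apply] at this ⊢
    omega
  · have := h.sum_eq
    simp +decide only [State.set_of_ne, State.set_same, ne_eq, f₂ _, f₁ _]
    omega

end Augment

/-- Find a node `source` with remaining supply, and a node `sink` with remaining demand, at least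
`scale`; the value is the number of nodes if there is none. -/
def findEnds : Program :=
  Reg.source ::= var Reg.nodes ;; Reg.sink ::= var Reg.nodes ;;
  forTo Reg.row Reg.nodes
    (.ite (ge (get Reg.supply (var Reg.row)) (var Reg.scale)) (Reg.source ::= var Reg.row) .skip ;;
      .ite (ge (get Reg.demand (var Reg.row)) (var Reg.scale)) (Reg.sink ::= var Reg.row) .skip)

/-- One augmentation, or one halving of the scale. -/
def solveStep : Program :=
  findEnds ;;
  .ite ((var Reg.nodes - var Reg.source) * (var Reg.nodes - var Reg.sink)) augment
    (Reg.scale ::= var Reg.scale / 2)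

/-- The scaling algorithm of Edmonds and Karp. -/
def solve : Program := .loop (var Reg.scale) solveStep

/-- `a` is a node with `d ≤ f a`, or else `a = N` and there is no such node below `j`. -/
def IsEnd (N j d : ℕ) (f : ℕ → ℕ) (a : ℕ) : Prop :=
  a < N ∧ d ≤ f a ∨ a = N ∧ ∀ v < j, f v < d

/-- The invariant of the scaling algorithm for the scale; `k` bounds the number of the remaining
steps: in each of the phases, at most `2 * N` units of flow of size `scale` are sent. -/
def State.IsScaled (N k : ℕ) (s : State) : Prop :=
  s Reg.scale 0 = 0 ∧ ∑ v ∈ Finset.range N, s Reg.supply v = 0 ∨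
    ∃ e, s Reg.scale 0 = 2 ^ e ∧ (∀ a b, s Reg.scale 0 ∣ s.mat Reg.flow a b) ∧
      ∑ v ∈ Finset.range N, s Reg.supply v < 2 * N * 2 ^ e ∧
      e * (2 * N + 1) + (∑ v ∈ Finset.range N, s Reg.supply v) / 2 ^ e + 1 ≤ k

section Solve

variable {R N k e : ℕ} {s : State} {P Q : ℕ → ℕ}

theorem IsEnd.succ_of_lt {j d a : ℕ} {f : ℕ → ℕ} (h : IsEnd N j d f a) (hj : f j < d) :
    IsEnd N (j + 1) d f a := by
  refine h.imp_right fun ⟨ha, hf⟩ => ⟨ha, fun v hv => ?_⟩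
  rcases Nat.lt_succ_iff_lt_or_eq.1 hv with hv | rfl
  · exact hf v hv
  · exact hj

theorem wp_findEnds (hN : s Reg.nodes 0 = N) (hR : N < R) :
    wp R findEnds (fun s' => IsEnd N N (s Reg.scale 0) (s Reg.supply) (s' Reg.source 0) ∧
      IsEnd N N (s Reg.scale 0) (s Reg.demand) (s' Reg.sink 0)) s := by
  rw [findEnds, wp_seq, wp_setVar, wp_seq, wp_setVar]
  refine wp_forTo (fun j s' => IsEnd N j (s Reg.scale 0) (s Reg.supply) (s' Reg.source 0) ∧
      IsEnd N j (s Reg.scale 0) (s Reg.demand) (s' Reg.sink 0))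
    (by simpa [State.set_apply] using hN) hR (fun j s₁ s₂ h h₁ => by simpa [h] using h₁)
    (by simp [IsEnd, State.set_apply, hN]) (fun j hj s₁ f₁ hj₁ ⟨h_source, h_sink⟩ => ?_)
    (fun s₁ _ h => h)
  simp +decide only [wp_seq, wp_ite, wp_setVar, wp_skip, val_ge_eq_zero, val_get,
    val_var, hj₁, State.set_apply, f₁ _, if_true, if_false, false_and, ne_eq, not_lt]
  exact ⟨fun hp => ⟨fun hq => ⟨.inl ⟨hj, hp⟩, .inl ⟨hj, hq⟩⟩,
      fun hq => ⟨.inl ⟨hj, hp⟩, h_sink.succ_of_lt hq⟩⟩,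
    fun hp => ⟨fun hq => ⟨h_source.succ_of_lt hp, .inl ⟨hj, hq⟩⟩,
      fun hq => ⟨h_source.succ_of_lt hp, h_sink.succ_of_lt hq⟩⟩⟩

theorem sum_lt_of_forall_lt {f : ℕ → ℕ} {d : ℕ} (hN : 0 < N) (hf : ∀ v < N, f v < d) :
    ∑ v ∈ Finset.range N, f v < N * d := by
  simpa using Finset.sum_lt_sum_of_nonempty (s := Finset.range N) (by simpa using hN.ne')
    fun v hv => hf v (Finset.mem_range.1 hv)

theorem isScaled_halve {f : ℕ → ℕ} (hN : 0 < N) (h_scale : s Reg.scale 0 = 2 ^ e)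
    (hd : ∀ a b, s Reg.scale 0 ∣ s.mat Reg.flow a b)
    (hf : ∑ v ∈ Finset.range N, s Reg.supply v = ∑ v ∈ Finset.range N, f v)
    (hfe : ∀ v < N, f v < 2 ^ e)
    (hk : e * (2 * N + 1) + (∑ v ∈ Finset.range N, s Reg.supply v) / 2 ^ e + 1 ≤ k) :
    (s.set Reg.scale 0 (s Reg.scale 0 / 2)).IsScaled N (k - 1) := by
  have h_sum := hf.trans_lt (sum_lt_of_forall_lt hN hfe)
  simp +decide only [State.IsScaled, State.mat_set_of_ne, State.set_of_ne, State.set_same,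
    Function.update_self, ne_eq]
  rcases e with _ | e
  · exact .inl ⟨by rw [h_scale]; rfl, hf.trans (Finset.sum_eq_zero fun v hv =>
      Nat.lt_one_iff.1 (hfe v (Finset.mem_range.1 hv)))⟩
  · have h_half : s Reg.scale 0 / 2 = 2 ^ e := by rw [h_scale, pow_succ]; omega
    rw [pow_succ] at h_sum
    have h_div : (∑ v ∈ Finset.range N, s Reg.supply v) / 2 ^ e < 2 * N :=
      (Nat.div_lt_iff_lt_mul (by positivity)).2 (by linarith)
    refine .inr ⟨e, h_half, fun a b => Dvd.dvd.trans ?_ (hd a b), by linarith, ?_⟩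
    · rw [h_half, h_scale]
      exact pow_dvd_pow _ e.le_succ
    · rw [add_one_mul] at hk
      generalize (∑ v ∈ Finset.range N, s Reg.supply v) / 2 ^ (e + 1) = q at hk
      omega

theorem wp_solveStep (hN : s Reg.nodes 0 = N) (hN₀ : 0 < N) (hR : N < R)
    (h : s.IsPartialFlow N P Q) (hs : s.IsScaled N k) (h_scale : s Reg.scale 0 ≠ 0) :
    wp R solveStep (fun s' => ∃ k' < k, s'.IsPartialFlow N P Q ∧ s'.IsScaled N k') s := by
  obtain ⟨e, he, hdvd, hsum, hk⟩ := hs.resolve_left fun h' => h_scale h'.1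
  have hk₀ : k - 1 < k := Nat.sub_lt ((Nat.le_add_left _ _).trans hk) one_pos
  refine wp_seq_frame (wp_findEnds hN hR) fun s₁ f₁ ⟨h_source, h_sink⟩ => ?_
  have h₁ : s₁.IsPartialFlow N P Q := by
    obtain ⟨hc, hb, hsum⟩ := h
    constructor <;> simpa +decide only [State.IsCertified, f₁.mat Reg.cost, f₁.mat Reg.flow, f₁ _]
  simp only [wp_ite, val_mul, val_sub, val_var, mul_eq_zero, f₁.array Reg.nodes, hN, ne_eq, not_or]
  rw [← f₁.array Reg.scale, ← f₁.array Reg.supply] at h_source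
  rw [← f₁.array Reg.scale, ← f₁.array Reg.demand] at h_sink
  rw [← f₁.array Reg.scale] at he
  rw [← f₁.array Reg.scale, ← f₁.mat Reg.flow] at hdvd
  rw [← f₁.array Reg.supply] at hsum hk
  constructor
  · rintro ⟨h_source_ne, h_sink_ne⟩
    obtain ⟨hs, hp⟩ := h_source.resolve_right (by omega)
    obtain ⟨ht, hq⟩ := h_sink.resolve_right (by omega)
    refine wp_mono (wp_frame (wp_augment ((f₁.var Reg.nodes).trans hN) hR h₁ hdvd hs ht hp hq)) ?_
    rintro s₂ ⟨⟨h₂, hdvd₂, hsum₂⟩, f₂⟩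
    refine ⟨k - 1, hk₀, h₂, .inr ⟨e, ?_⟩⟩
    rw [f₂.array Reg.scale]
    rw [he] at hsum₂
    rw [← hsum₂, Nat.add_div_right _ (by positivity)] at hk
    exact ⟨he, hdvd₂, by omega, by omega⟩
  · intro h_none
    have h_small : ∃ f : ℕ → ℕ, ∑ v ∈ Finset.range N, s₁ Reg.supply v = ∑ v ∈ Finset.range N, f v ∧
        ∀ v < N, f v < 2 ^ e := by
      rw [he] at h_source h_sink
      rcases h_none with h_none | h_none
      · exact ⟨_, rfl, (h_source.resolve_left (by omega)).2⟩
      · exact ⟨_, h₁.sum_eq, (h_sink.resolve_left (by omega)).2⟩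
    obtain ⟨f, hf, hfe⟩ := h_small
    rw [wp_setVar, val_div, val_var, val_ofNat]
    refine ⟨k - 1, hk₀, ?_, isScaled_halve hN₀ he hdvd hf hfe hk⟩
    obtain ⟨hc, hb, hsum⟩ := h₁
    constructor <;> simpa +decide only [State.IsCertified, State.mat_set_of_ne, State.set_of_ne,
      ne_eq]

theorem wp_solve (hN : s Reg.nodes 0 = N) (hN₀ : 0 < N) (hR : N < R) (h : s.IsPartialFlow N P Q)
    (h_scale : s Reg.scale 0 = 2 ^ e) (hd : ∀ a b, s Reg.scale 0 ∣ s.mat Reg.flow a b)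
    (h_sum : ∑ v ∈ Finset.range N, s Reg.supply v < 2 ^ e) (hRe : e * (2 * N + 1) + 1 < R) :
    wp R solve (fun s' => (∃ π, IsCertificate N (s.mat Reg.cost) (s'.mat Reg.flow) π) ∧
      Balanced N (s'.mat Reg.flow) P Q) s := by
  refine wp_loop (k := e * (2 * N + 1) + 1) (fun k s' => s'.IsPartialFlow N P Q ∧ s'.IsScaled N k)
    hRe ⟨h, .inr ⟨e, h_scale, hd, ?_, ?_⟩⟩ ?_ ?_
  · exact h_sum.trans_le (Nat.le_mul_of_pos_left _ (by omega))
  · rw [Nat.div_eq_of_lt h_sum]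
  · rintro k s₁ f₁ ⟨⟨hc, hb, hsum⟩, hs⟩ h₀
    rw [val_var] at h₀
    have hp : ∑ v ∈ Finset.range N, s₁ Reg.supply v = 0 := by
      rcases hs with hs | ⟨e, he, -⟩
      · exact hs.2
      · rw [h₀] at he
        exact absurd he (by positivity)
    have hq := hsum.symm.trans hp
    rw [Finset.sum_eq_zero_iff] at hp hq
    refine ⟨⟨s₁ Reg.potential, by rwa [← f₁.mat Reg.cost]⟩, fun w hw => ?_⟩
    have := hb w hw
    rwa [Pi.add_apply, Pi.add_apply, hp w (by simpa using hw), hq w (by simpa using hw), add_zero,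
      add_zero] at this
  · rintro k s₁ f₁ ⟨h₁, hs⟩ h₀
    exact wp_solveStep ((f₁.var Reg.nodes).trans hN) hN₀ hR h₁ hs h₀

end Solve

/-! ### The program for minimum cost flow with outliers -/

open MCFOInstance

/-- The number with index `r` of the three numbers in the input for the pair `(row, col)`. -/
def readPair (r : ℕ) : Expr :=
  get Reg.input (.const (3 + r) + 4 * var Reg.vertices +
    3 * (var Reg.row * var Reg.vertices + var Reg.col))

/-- Computation of a common denominator of the costs, and of a bound for the scaled costs. -/
def denominators : Program :=
  forPairs Reg.row Reg.col Reg.vertices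
    (.ite (readPair 0)
      (Reg.denominator ::= readPair 2 * var Reg.denominator ;;
        Reg.costBound ::= readPair 1 * var Reg.costBound + var Reg.costBound ;;
        Reg.costBound ::= readPair 2 * var Reg.costBound)
      .skip)

/-- Initialization of the numbers of vertices and nodes, the common denominator of the costs, and
the cost of the pairs that are not arcs. -/
def setup : Program :=
  (Reg.vertices ::= get Reg.input 1 ;;
    Reg.nodes ::= var Reg.vertices + var Reg.vertices + var Reg.vertices + 2 ;;
    Reg.denominator ::= 1 ;;
    Reg.costBound ::= 1) ;;
  denominators ;;
  Reg.bigCost ::= get Reg.input 1 * var Reg.costBound ;;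
  Reg.bigCost ::= var Reg.bigCost + var Reg.bigCost + var Reg.bigCost +
    (var Reg.costBound + var Reg.costBound) + 1

/-- All pairs of nodes receive the cost `bigCost`. -/
def fillCosts : Program :=
  forPairs Reg.row Reg.col Reg.nodes
    (setEntry Reg.cost (var Reg.row) (var Reg.col) (var Reg.bigCost))

/-- The arcs that do not join two vertices receive the cost `0`. -/
def zeroCosts : Program :=
  forTo Reg.row Reg.vertices
    (setEntry Reg.cost (var Reg.vertices + var Reg.row) (var Reg.row) 0 ;;
      setEntry Reg.cost (var Reg.vertices + var Reg.row) (3 * var Reg.vertices) 0 ;;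
      setEntry Reg.cost (var Reg.row) (2 * var Reg.vertices + var Reg.row) 0 ;;
      setEntry Reg.cost (3 * var Reg.vertices + 1) (2 * var Reg.vertices + var Reg.row) 0) ;;
  setEntry Reg.cost (3 * var Reg.vertices + 1) (3 * var Reg.vertices) 0

/-- The edges receive their costs, multiplied by the common denominator. -/
def edgeCosts : Program :=
  forPairs Reg.row Reg.col Reg.vertices
    (.ite (readPair 0)
      (setEntry Reg.cost (var Reg.row) (var Reg.col)
        (readPair 1 * (var Reg.denominator / readPair 2)))
      .skip)

/-- Computation of the costs in the network. -/
def netCosts : Program := fillCosts ;; zeroCosts ;; edgeCosts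

/-- The state after `setup`. -/
structure State.IsSetUp (I : MCFOInstance) (D H : ℕ) (s : State) : Prop where
  input : s Reg.input = I.input
  vertices : s Reg.vertices 0 = I.n
  nodes : s Reg.nodes 0 = 3 * I.n + 2
  denominator : s Reg.denominator 0 = D
  bigCost : s Reg.bigCost 0 = (3 * I.n + 2) * H + 1
  isCommonDenominator : I.IsCommonDenominator (Set.Iio I.n ×ˢ Set.Iio I.n) D H

/-- The arcs that do not join two vertices and that have received the cost `0` in the first `k`
iterations of the loop in `zeroCosts`. -/
def IsFreeArcBefore (n k u v : ℕ) : Prop :=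
  n ≤ u ∧ u < n + k ∧ (v + n = u ∨ v = 3 * n) ∨ u < k ∧ v = 2 * n + u ∨
    u = 3 * n + 1 ∧ 2 * n ≤ v ∧ v < 2 * n + k

section Costs

variable {I : MCFOInstance} {R D H N n u v : ℕ} {s : State}

theorem val_readPair (r : ℕ) (h_input : s Reg.input = I.input)
    (h_vertices : s Reg.vertices 0 = I.n) :
    (readPair r).val s = I.pairEntry r (s Reg.row 0) (s Reg.col 0) := by
  rw [pairEntry, ← h_input, ← h_vertices]
  rfl

theorem wp_denominators (h_input : s Reg.input = I.input) (h_vertices : s Reg.vertices 0 = I.n)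
    (hR : I.n < R)
    (h : I.IsCommonDenominator ∅ (s Reg.denominator 0) (s Reg.costBound 0)) :
    wp R denominators (fun s' => I.IsCommonDenominator (Set.Iio I.n ×ˢ Set.Iio I.n)
      (s' Reg.denominator 0) (s' Reg.costBound 0)) s := by
  refine wp_forPairs_of_set
    (fun S s' => I.IsCommonDenominator S (s' Reg.denominator 0) (s' Reg.costBound 0))
    h_vertices hR (fun S s₁ s₂ h h₁ => by simpa [h] using h₁) h
    (fun S u hu v hv s₁ f₁ hu₁ hv₁ h₁ => ?_) (fun s₁ _ h => h)
  have h_read (r x y : ℕ) : (readPair r).val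
      ((s₁.set Reg.denominator 0 x).set Reg.costBound 0 y) = I.pairEntry r u v := by
    simp +decide only [val_readPair (I := I), State.set_of_ne, ne_eq, f₁.array Reg.input,
      f₁.var Reg.vertices, h_input, h_vertices, hu₁, hv₁]
  have h_read₀ (r : ℕ) : (readPair r).val s₁ = I.pairEntry r u v := by
    rw [val_readPair r ((f₁.array Reg.input).trans h_input)
      ((f₁.var Reg.vertices).trans h_vertices), hu₁, hv₁]
  have h_read₁ (r x : ℕ) : (readPair r).val (s₁.set Reg.denominator 0 x) = I.pairEntry r u v := by
    simp +decide only [val_readPair (I := I), State.set_of_ne, ne_eq, f₁.array Reg.input,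
      f₁.var Reg.vertices, h_input, h_vertices, hu₁, hv₁]
  simp +decide only [wp_ite, wp_seq, wp_setVar, wp_skip, val_add, val_mul, val_var, h_read₀,
    h_read₁, h_read, ne_eq, State.set_apply, if_true]
  exact ⟨fun h₀ => h₁.insert_edge (pairEntry_two_pos hu hv h₀), fun h₀ => h₁.insert_nonedge h₀⟩

theorem isCommonDenominator_empty (I : MCFOInstance) : I.IsCommonDenominator ∅ 1 1 :=
  ⟨one_pos, le_rfl, fun _ h => h.elim, fun _ h => h.elim⟩

theorem wp_setup (hR : I.n < R) :
    wp R setup (fun s' => ∃ D H, s'.IsSetUp I D H) (initial I.encode) := by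
  have h_input : initial I.encode Reg.input = I.input := rfl
  refine wp_seq_frame (Q₁ := fun s₁ => s₁ Reg.input = I.input ∧ s₁ Reg.vertices 0 = I.n ∧
    s₁ Reg.nodes 0 = 3 * I.n + 2 ∧ s₁ Reg.denominator 0 = 1 ∧ s₁ Reg.costBound 0 = 1) ?_ ?_
  · simp +decide [wp_seq, State.set_of_ne, State.set_apply, h_input, input_one]
    ring
  · rintro s₁ - ⟨h_input₁, h_vertices, h_nodes, h_denominator, h_bound⟩
    refine wp_seq_frame (wp_denominators h_input₁ h_vertices hR ?_) fun s₂ f₂ h₂ => ?_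
    · rw [h_denominator, h_bound]
      exact isCommonDenominator_empty I
    · refine ⟨s₂ Reg.denominator 0, s₂ Reg.costBound 0, ?_⟩
      constructor <;> simp +decide [State.set_of_ne, State.set_apply, f₂.array Reg.input,
        f₂.var Reg.vertices, f₂.var Reg.nodes, h_input₁, h_vertices, h_nodes, input_one, h₂]
      ring

theorem wp_fillCosts (h_nodes : s Reg.nodes 0 = N) (hR : N < R) :
    wp R fillCosts (fun s' => ∀ u < N, ∀ v < N, s'.mat Reg.cost u v = s Reg.bigCost 0) s := by
  refine wp_forPairs_of_set
    (fun S s' => ∀ u v, (u, v) ∈ S → s'.mat Reg.cost u v = s Reg.bigCost 0) h_nodes hR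
    (fun S s₁ s₂ h h₁ => by simpa [State.mat, h] using h₁) (fun u v h => h.elim)
    (fun S u _ v _ s₁ f₁ hu₁ hv₁ h₁ => ?_) (fun s₁ _ h u hu v hv => h u v ⟨hu, hv⟩)
  simp only [wp_setEntry, State.mat_set_same, val_var, hu₁, hv₁, f₁.var Reg.bigCost]
  intro u' v' h
  split_ifs with h'
  · rfl
  · exact h₁ u' v' (h.resolve_left (by simpa using h'))

open Classical in
theorem wp_zeroCosts (h_vertices : s Reg.vertices 0 = n) (hR : n < R) :
    wp R zeroCosts (fun s' => s'.mat Reg.cost = fun u v =>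
      if IsArcShape n u v ∧ ¬(u < n ∧ v < n) then 0 else s.mat Reg.cost u v) s := by
  refine wp_seq_frame (wp_forTo (fun k s' => s'.mat Reg.cost = fun u v =>
      if IsFreeArcBefore n k u v then 0 else s.mat Reg.cost u v) h_vertices hR
    (fun k s₁ s₂ h h₁ => (State.mat_congr (h _ (by decide))).trans h₁) ?_
    (fun k hk s₁ f₁ hk₁ h₁ => ?_) fun s₁ _ h => h) fun s₁ f₁ h₁ => ?_
  · funext u v
    rw [if_neg (by unfold IsFreeArcBefore; omega)]
  · simp +decide only [wp_seq, wp_setEntry, State.mat_set_same, State.set_of_ne, val_add, val_mul,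
      val_var, val_ofNat, hk₁, h_vertices, f₁.var Reg.vertices, ne_eq, h₁, ← ite_or]
    funext u v
    exact if_congr (by unfold IsFreeArcBefore; omega) rfl rfl
  · simp only [wp_setEntry, State.mat_set_same, val_add, val_mul, val_var, val_ofNat,
      f₁.var Reg.vertices, h_vertices, h₁, ← ite_or]
    funext u v
    exact if_congr (by unfold IsFreeArcBefore IsArcShape; omega) rfl rfl

open Classical in
theorem wp_edgeCosts (h : s.IsSetUp I D H) (hR : I.n < R) :
    wp R edgeCosts (fun s' => s'.mat Reg.cost = fun u v =>
      if (u, v) ∈ Set.Iio I.n ×ˢ Set.Iio I.n ∧ I.pairEntry 0 u v ≠ 0 then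
        I.pairEntry 1 u v * (D / I.pairEntry 2 u v) else s.mat Reg.cost u v) s := by
  refine wp_forPairs_of_set (fun S s' => s'.mat Reg.cost = fun u v =>
      if (u, v) ∈ S ∧ I.pairEntry 0 u v ≠ 0 then I.pairEntry 1 u v * (D / I.pairEntry 2 u v)
      else s.mat Reg.cost u v) h.vertices hR
    (fun S s₁ s₂ h h₁ => (State.mat_congr (h _ (by decide) (by decide))).trans h₁) (by simp)
    (fun S u hu v hv s₁ f₁ hu₁ hv₁ h₁ => ?_) (fun s₁ _ h => by convert h)
  simp only [wp_ite, wp_setEntry, wp_skip, val_mul, val_div, val_var, State.mat_set_same,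
    val_readPair (I := I) _ ((f₁.array Reg.input).trans h.input)
      ((f₁.var Reg.vertices).trans h.vertices), hu₁, hv₁, f₁.var Reg.denominator, h.denominator, h₁]
  refine ⟨fun h₀ => ?_, fun h₀ => ?_⟩ <;> funext u' v' <;>
    by_cases h_eq : u' = u ∧ v' = v
  · obtain ⟨rfl, rfl⟩ := h_eq
    simp [h₀]
  · simp [h_eq]
  · obtain ⟨rfl, rfl⟩ := h_eq
    simp [h₀]
  · simp [h_eq]

theorem State.IsSetUp.frame {c : Program} (h : s.IsSetUp I D H) (f : c.Frame s s')
    (hc : ∀ a ∈ [Reg.input, Reg.vertices, Reg.nodes, Reg.denominator, Reg.bigCost],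
      c.writes a = false := by decide) : s'.IsSetUp I D H := by
  simp only [List.forall_mem_cons] at hc
  exact ⟨(f _ hc.1).trans h.input, (f.var _ hc.2.1).trans h.vertices,
    (f.var _ hc.2.2.1).trans h.nodes, (f.var _ hc.2.2.2.1).trans h.denominator,
    (f.var _ hc.2.2.2.2.1).trans h.bigCost, h.isCommonDenominator⟩

open Classical in
theorem wp_netCosts_eq (h : s.IsSetUp I D H) (hR : 3 * I.n + 2 < R) :
    wp R netCosts (fun s' => ∀ u < 3 * I.n + 2, ∀ v < 3 * I.n + 2, s'.mat Reg.cost u v =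
      if (u, v) ∈ Set.Iio I.n ×ˢ Set.Iio I.n ∧ I.pairEntry 0 u v ≠ 0 then
        I.pairEntry 1 u v * (D / I.pairEntry 2 u v)
      else if IsArcShape I.n u v ∧ ¬(u < I.n ∧ v < I.n) then 0
      else (3 * I.n + 2) * H + 1) s := by
  refine wp_seq_frame (wp_fillCosts h.nodes hR) fun s₁ f₁ h₁ => ?_
  refine wp_seq_frame (wp_zeroCosts (h.frame f₁).vertices (by omega)) fun s₂ f₂ h₂ => ?_
  refine wp_mono (wp_edgeCosts ((h.frame f₁).frame f₂) (by omega)) fun s₃ h₃ u hu v hv => ?_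
  simp only [h₃, h₂, h₁ u hu v hv, h.bigCost]

theorem wp_netCosts (h : s.IsSetUp I D H) (hR : 3 * I.n + 2 < R) :
    wp R netCosts (fun s' => I.IsNetCost D H (s'.mat Reg.cost)) s := by
  refine wp_mono (wp_netCosts_eq h hR) fun s' h' => ?_
  have h_edge (i j : Fin I.n) (hE : (i, j) ∈ I.E) : s'.mat Reg.cost i j =
      (I.cost (i, j)).num * (D / (I.cost (i, j)).den) := by
    rw [h' i (by omega) j (by omega), if_pos ⟨⟨i.2, j.2⟩, (pairEntry_zero_ne_zero i j).2 hE⟩,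
      pairEntry_one hE, pairEntry_two hE]
  have h_zero (u v : ℕ) (h_shape : IsArcShape I.n u v) (huv : ¬(u < I.n ∧ v < I.n)) :
      s'.mat Reg.cost u v = 0 := by
    rw [h' u (by unfold IsArcShape at h_shape; omega) v (by unfold IsArcShape at h_shape; omega),
      if_neg fun h₁ => huv h₁.1, if_pos ⟨h_shape, huv⟩]
  refine ⟨h.isCommonDenominator.pos, fun i j hE => ?_, h_zero, fun u v h_arc => ?_,
    fun u hu v hv h_arc => ?_⟩
  · have h_dvd := h.isCommonDenominator.dvd (i, j) ⟨i.2, j.2⟩ ((pairEntry_zero_ne_zero i j).2 hE)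
    rw [h_edge i j hE, mul_assoc, Nat.div_mul_cancel (pairEntry_two hE ▸ h_dvd)]
  · by_cases huv : u < I.n ∧ v < I.n
    · obtain ⟨hu, hv⟩ := huv
      have hE := h_arc.2 hu hv
      have h_le := h.isCommonDenominator.mul_le (u, v) ⟨hu, hv⟩
        ((pairEntry_zero_ne_zero ⟨u, hu⟩ ⟨v, hv⟩).2 hE)
      rw [pairEntry_one hE] at h_le
      exact (h_edge _ _ hE).trans_le ((Nat.mul_le_mul_left _ (Nat.div_le_self _ _)).trans h_le)
    · exact (h_zero u v h_arc.1 huv).trans_le (Nat.zero_le _)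
  · rw [h' u hu v hv, if_neg, if_neg]
    · exact fun ⟨h_shape, huv⟩ => h_arc ⟨h_shape, fun hu' hv' => (huv ⟨hu', hv'⟩).elim⟩
    · rintro ⟨⟨hu', hv'⟩, h₀⟩
      exact h_arc ⟨.inl ⟨hu', hv'⟩,
        fun _ _ => (pairEntry_zero_ne_zero ⟨u, hu'⟩ ⟨v, hv'⟩).1 h₀⟩

end Costs

/-- Computation of the supplies and demands in the network and of their totals. -/
def balances : Program :=
  forTo Reg.row Reg.vertices
    (.assign Reg.supply (var Reg.vertices + var Reg.row) (get Reg.input (4 + 2 * var Reg.row)) ;;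
      Reg.totalDemand ::= var Reg.totalDemand + get Reg.input (4 + 2 * var Reg.row) ;;
      .assign Reg.demand (2 * var Reg.vertices + var Reg.row)
        (get Reg.input (4 + 2 * var Reg.vertices + 2 * var Reg.row)) ;;
      Reg.totalSupply ::= var Reg.totalSupply +
        get Reg.input (4 + 2 * var Reg.vertices + 2 * var Reg.row)) ;;
  .assign Reg.demand (3 * var Reg.vertices) (get Reg.input 2) ;;
  Reg.totalSupply ::= var Reg.totalSupply + get Reg.input 2 ;;
  .assign Reg.supply (3 * var Reg.vertices + 1) (var Reg.totalSupply - var Reg.totalDemand)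

/-- Computation of the network. -/
def prepare : Program := setup ;; netCosts ;; balances

/-- The supplies and demands of the vertices before `k` have been stored and added up. -/
structure State.HasBalancesBefore (I : MCFOInstance) (k : ℕ) (s : State) : Prop where
  supply : ∀ w, s Reg.supply w = if I.n ≤ w ∧ w < I.n + k then I.demandAt (w - I.n) else 0
  demand : ∀ w, s Reg.demand w =
    if 2 * I.n ≤ w ∧ w < 2 * I.n + k then I.supplyAt (w - 2 * I.n) else 0
  totalDemand : s Reg.totalDemand 0 = ∑ j ∈ Finset.range k, I.demandAt j
  totalSupply : s Reg.totalSupply 0 = ∑ j ∈ Finset.range k, I.supplyAt j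

/-- The supplies and demands in the network and their totals are stored. -/
structure State.HasBalances (I : MCFOInstance) (s : State) : Prop where
  supply : s Reg.supply = I.netSupply
  demand : s Reg.demand = I.netDemand
  totalDemand : s Reg.totalDemand 0 = I.totalDemand
  totalSupply : s Reg.totalSupply 0 = I.totalSupply + I.m

/-- The state after `prepare`. -/
structure State.IsPrepared (I : MCFOInstance) (D H : ℕ) (s : State) : Prop where
  output : s Reg.output 0 = 0
  vertices : s Reg.vertices 0 = I.n
  nodes : s Reg.nodes 0 = 3 * I.n + 2
  bigCost : s Reg.bigCost 0 = (3 * I.n + 2) * H + 1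
  isNetCost : I.IsNetCost D H (s.mat Reg.cost)
  hasBalances : s.HasBalances I
  flow : ∀ u v, s.mat Reg.flow u v = 0
  potential : ∀ v, s Reg.potential v = 0

section Prepare

variable {I : MCFOInstance} {R D H k : ℕ} {s : State}

theorem ite_eq_update {α : Type*} {a k w : ℕ} (f : ℕ → α) (y : α) :
    (if w = a + k then f k else if a ≤ w ∧ w < a + k then f (w - a) else y) =
      if a ≤ w ∧ w < a + (k + 1) then f (w - a) else y := by
  split_ifs <;> first | rfl | omega | simp_all

theorem State.hasBalancesBefore_zero (h_supply : s Reg.supply = 0) (h_demand : s Reg.demand = 0)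
    (h_totalDemand : s Reg.totalDemand = 0) (h_totalSupply : s Reg.totalSupply = 0) :
    s.HasBalancesBefore I 0 := by
  constructor <;> simp +contextual [h_supply, h_demand, h_totalDemand, h_totalSupply]

theorem wp_balances (h_input : s Reg.input = I.input) (h_vertices : s Reg.vertices 0 = I.n)
    (hR : I.n < R) (h : s.HasBalancesBefore I 0) :
    wp R balances (State.HasBalances I) s := by
  refine wp_seq_frame (wp_forTo (State.HasBalancesBefore I) h_vertices hR ?_ h
    (fun k hk s₁ f₁ hk₁ h₁ => ?_) fun s₁ _ h => h) fun s₁ f₁ h₁ => ?_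
  · rintro k s₁ s₂ h ⟨h_supply, h_demand, h_totalDemand, h_totalSupply⟩
    constructor <;> simpa +decide only [h, ne_eq]
  · obtain ⟨h_supply, h_demand, h_totalDemand, h_totalSupply⟩ := h₁
    constructor <;> simp +decide [State.set_apply, f₁.array Reg.input, f₁.var Reg.vertices,
      h_input, h_vertices, hk₁, h_supply, h_demand, h_totalDemand, h_totalSupply, input_demand hk,
      input_supply hk, Finset.sum_range_succ, ite_eq_update]
  · obtain ⟨h_supply, h_demand, h_totalDemand, h_totalSupply⟩ := h₁
    have h_netSupply : Function.update (s₁ Reg.supply) (3 * I.n + 1)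
        (I.totalSupply + I.m - I.totalDemand) = I.netSupply := by
      funext w
      simp only [Function.update_apply, h_supply, netSupply]
      split_ifs <;> first | rfl | omega
    have h_netDemand : Function.update (s₁ Reg.demand) (3 * I.n) I.m = I.netDemand := by
      funext w
      simp only [Function.update_apply, h_demand, netDemand]
      split_ifs <;> first | rfl | omega
    rw [← totalDemand] at h_totalDemand
    rw [← totalSupply] at h_totalSupply
    constructor <;> simp +decide [State.set_same, State.set_of_ne, f₁.array Reg.input,
      f₁.var Reg.vertices, h_input, h_vertices, h_totalDemand, h_totalSupply, input_two,
      h_netSupply, h_netDemand]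

theorem wp_prepare (hR : 3 * I.n + 2 < R) :
    wp R prepare (fun s' => ∃ D H, s'.IsPrepared I D H) (initial I.encode) := by
  have h_zero (a : ℕ) (ha : a ≠ 0) : initial I.encode a = 0 := by
    funext i
    exact if_neg ha
  refine wp_mono (wp_frame (Q := fun s' => ∃ D H, s'.IsSetUp I D H ∧
    I.IsNetCost D H (s'.mat Reg.cost) ∧ s'.HasBalances I) ?_) ?_
  · refine wp_seq_frame (wp_setup (by omega)) fun s₁ f₁ ⟨D, H, h₁⟩ => ?_
    refine wp_seq_frame (wp_netCosts h₁ hR) fun s₂ f₂ h_cost => ?_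
    have h₂ := h₁.frame f₂
    have h_zero₂ (a : ℕ) (ha : a ≠ 0) (ha₁ : setup.writes a = false)
        (ha₂ : netCosts.writes a = false) : s₂ a = 0 :=
      (f₂ a ha₂).trans ((f₁ a ha₁).trans (h_zero a ha))
    refine wp_mono (wp_frame (wp_balances h₂.input h₂.vertices (by omega)
      (State.hasBalancesBefore_zero ?_ ?_ ?_ ?_))) fun s₃ ⟨h₃, f₃⟩ =>
        ⟨D, H, h₂.frame f₃, f₃.mat Reg.cost ▸ h_cost, h₃⟩
    all_goals exact h_zero₂ _ (by decide) (by decide) (by decide)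
  · rintro s' ⟨⟨D, H, h, h_cost, h_balances⟩, f⟩
    refine ⟨D, H, ?_, h.vertices, h.nodes, h.bigCost, h_cost, h_balances, fun u v => ?_,
      fun v => ?_⟩
    · rw [f.array Reg.output, h_zero _ (by decide), Pi.zero_apply]
    · rw [State.mat, f.array Reg.flow, h_zero _ (by decide), Pi.zero_apply]
    · rw [f.array Reg.potential, h_zero _ (by decide), Pi.zero_apply]

end Prepare

/-- Append the value of `e` to the output. -/
def emit (e : Expr) : Program :=
  .assign Reg.output (var Reg.output + 1) e ;;
  Reg.output ::= var Reg.output + 1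

/-- Output the solution that corresponds to the stored flow. -/
def emitSolution : Program :=
  emit 1 ;;
  forPairs Reg.row Reg.col Reg.vertices (emit (entry Reg.flow (var Reg.row) (var Reg.col))) ;;
  forTo Reg.row Reg.vertices
    (emit (entry Reg.flow (var Reg.vertices + var Reg.row) (var Reg.row))) ;;
  forTo Reg.row Reg.vertices
    (emit (entry Reg.flow (var Reg.row) (2 * var Reg.vertices + var Reg.row)))

section Output

variable {I : MCFOInstance} {R m i j v : ℕ} {s s' : State} {c : Program} {e : Expr}

theorem output_eq_map : output s = (List.range (s Reg.output 0)).map fun i =>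
    s Reg.output (i + 1) := by
  rw [output, List.ofFn_eq_map, ← List.map_coe_finRange_eq_range, List.map_map]
  rfl

theorem output_congr (h : s' Reg.output = s Reg.output) : output s' = output s := by
  rw [output_eq_map, output_eq_map, h]

theorem output_eq_append {x : ℕ} (h_length : s' Reg.output 0 = s Reg.output 0 + 1)
    (h_last : s' Reg.output (s Reg.output 0 + 1) = x)
    (h : ∀ i < s Reg.output 0, s' Reg.output (i + 1) = s Reg.output (i + 1)) :
    output s' = output s ++ [x] := by
  rw [output_eq_map, output_eq_map, h_length, List.range_succ, List.map_append, List.map_singleton,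
    h_last]
  exact congrArg (· ++ [x]) (List.map_congr_left fun i hi => h i (List.mem_range.1 hi))

theorem wp_emit : wp R (emit e) (fun s' => output s' = output s ++ [e.val s]) s := by
  simp only [emit, wp_seq, wp_assign, wp_setVar, val_add, val_var, val_ofNat]
  apply output_eq_append <;> simp +contextual [State.set_apply, ne_of_lt]

theorem wp_forTo_output (f : ℕ → List ℕ) (hm : s v 0 = m) (hmR : m < R)
    (hstep : ∀ k < m, ∀ s₁, (forTo i v c).Frame s s₁ → s₁ i 0 = k →
      wp R c (fun s' => output s' = output s₁ ++ f k) s₁)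
    (hv : (forTo i v c).writes v = false := by decide) (hi : c.writes i = false := by decide)
    (h_output : Reg.output ≠ i := by decide) :
    wp R (forTo i v c) (fun s' => output s' = output s ++ (List.range m).flatMap f) s := by
  refine wp_forTo (fun k s' => output s' = output s ++ (List.range k).flatMap f) hm hmR
    (fun k s₁ s₂ h h₁ => (output_congr (h _ h_output)).trans h₁) (by simp)
    (fun k hk s₁ f₁ hk₁ h₁ => ?_) (fun s₁ _ h => h) hv hi
  refine wp_mono (hstep k hk s₁ f₁ hk₁) fun s₂ h₂ => ?_
  rw [h₂, h₁, List.range_succ, List.flatMap_append, List.flatMap_singleton, List.append_assoc]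

theorem wp_forPairs_output (f : ℕ → ℕ → List ℕ) (hm : s v 0 = m) (hmR : m < R)
    (hstep : ∀ k < m, ∀ l < m, ∀ s₁, (forPairs i j v c).Frame s s₁ → s₁ i 0 = k → s₁ j 0 = l →
      wp R c (fun s' => output s' = output s₁ ++ f k l) s₁)
    (hv : (forPairs i j v c).writes v = false := by decide)
    (hi : (forTo j v c).writes i = false := by decide) (hj : c.writes j = false := by decide)
    (h_output : Reg.output ≠ i ∧ Reg.output ≠ j := by decide) :
    wp R (forPairs i j v c) (fun s' => output s' = output s ++
      (List.range m).flatMap fun k => (List.range m).flatMap (f k)) s := by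
  refine wp_forTo_output _ hm hmR (fun k hk s₁ f₁ hk₁ => ?_) hv hi h_output.1
  refine wp_forTo_output (f k) ((f₁.var v hv).trans hm) hmR (fun l hl s₂ f₂ hl₂ => ?_)
    (writes_forTo.1 hv).2 hj h_output.2
  exact hstep k hk l hl s₂ (f₁.trans (f₂.mono fun a ha => (writes_forTo.1 ha).2))
    ((f₂.var i hi).trans hk₁) hl₂

theorem encodeAnswer_solutionOf (x : ℕ → ℕ → ℕ) : I.encodeAnswer (some (I.solutionOf x)) =
    [1] ++ ((List.range I.n).flatMap fun u => (List.range I.n).flatMap fun v => [x u v]) ++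
      ((List.range I.n).flatMap fun v => [x (I.n + v) v]) ++
      ((List.range I.n).flatMap fun v => [x v (2 * I.n + v)]) := by
  simp only [encodeAnswer, solutionOf, ← List.map_coe_finRange_eq_range, List.flatMap_map]
  simp only [List.map_eq_flatMap]

theorem wp_emitSolution (h_vertices : s Reg.vertices 0 = I.n) (hR : I.n < R) :
    wp R emitSolution (fun s' => output s' =
      output s ++ I.encodeAnswer (some (I.solutionOf (s.mat Reg.flow)))) s := by
  refine wp_seq_frame wp_emit fun s₁ f₁ h₁ => ?_
  have h_vertices₁ := (f₁.var Reg.vertices).trans h_vertices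
  refine wp_seq_frame (wp_forPairs_output (fun u v => [s.mat Reg.flow u v]) h_vertices₁ hR
    fun u _ v _ s' f' hu hv => ?_) fun s₂ f₂ h₂ => ?_
  · simpa only [val_entry, val_var, hu, hv, f'.mat Reg.flow, f₁.mat Reg.flow] using
      wp_emit (s := s') (e := entry Reg.flow (var Reg.row) (var Reg.col))
  have h_vertices₂ := (f₂.var Reg.vertices).trans h_vertices₁
  refine wp_seq_frame (wp_forTo_output (fun v => [s.mat Reg.flow (I.n + v) v]) h_vertices₂ hR
    fun v _ s' f' hv => ?_) fun s₃ f₃ h₃ => ?_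
  · simpa only [val_entry, val_var, val_add, hv, f'.mat Reg.flow, f₂.mat Reg.flow,
      f₁.mat Reg.flow, f'.var Reg.vertices, h_vertices₂] using
      wp_emit (s := s') (e := entry Reg.flow (var Reg.vertices + var Reg.row) (var Reg.row))
  have h_vertices₃ := (f₃.var Reg.vertices).trans h_vertices₂
  refine wp_mono (wp_forTo_output (fun v => [s.mat Reg.flow v (2 * I.n + v)]) h_vertices₃ hR
    fun v _ s' f' hv => ?_) fun s₄ h₄ => ?_
  · simpa only [val_entry, val_var, val_add, val_mul, val_ofNat, hv, f'.mat Reg.flow,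
      f₃.mat Reg.flow, f₂.mat Reg.flow, f₁.mat Reg.flow, f'.var Reg.vertices, h_vertices₃] using
      wp_emit (s := s') (e := entry Reg.flow (var Reg.row) (2 * var Reg.vertices + var Reg.row))
  · rw [h₄, h₃, h₂, h₁, encodeAnswer_solutionOf, val_ofNat]
    simp only [List.append_assoc]

end Output

/-- The scale becomes a power of two that is larger than the total supply. -/
def initScale : Program :=
  Reg.scale ::= 1 ;;
  .loop (ge (var Reg.totalSupply) (var Reg.scale)) (Reg.scale ::= var Reg.scale + var Reg.scale)

/-- Check whether some pair of nodes that is not an arc carries flow. -/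
def checkFlow : Program :=
  Reg.infeasible ::= 0 ;;
  forPairs Reg.row Reg.col Reg.nodes
    (.ite (entry Reg.flow (var Reg.row) (var Reg.col))
      (.ite (ge (entry Reg.cost (var Reg.row) (var Reg.col)) (var Reg.bigCost))
        (Reg.infeasible ::= 1) .skip)
      .skip)

/-- Output the answer for the stored flow, which is optimal in the network. -/
def emitAnswer : Program :=
  checkFlow ;; .ite (var Reg.infeasible) (emit 0) emitSolution

/-- The algorithm for minimum cost flow with outliers. -/
def mcfoProgram : Program :=
  prepare ;;
  .ite (ge (var Reg.totalSupply) (var Reg.totalDemand))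
    (initScale ;; solve ;; emitAnswer)
    (emit 0)

/-- The program has output a correct answer. -/
def HasCorrectOutput (I : MCFOInstance) (s : State) : Prop :=
  ∃ b : Option (MCFOFlow I.n ℕ), I.IsCorrectAnswer b ∧ output s = I.encodeAnswer b

section Correctness

variable {I : MCFOInstance} {R N D H : ℕ} {s : State}

theorem wp_initScale (hR : Nat.size (s Reg.totalSupply 0) < R) :
    wp R initScale (fun s' => ∃ e ≤ Nat.size (s Reg.totalSupply 0),
      s' Reg.scale 0 = 2 ^ e ∧ s Reg.totalSupply 0 < 2 ^ e) s := by
  rw [initScale, wp_seq, wp_setVar]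
  refine wp_loop (fun k s' => ∃ e, e + k = Nat.size (s Reg.totalSupply 0) ∧
    s' Reg.scale 0 = 2 ^ e) hR ⟨0, zero_add _, by simp [State.set_apply]⟩ ?_ ?_
  · rintro k s₁ f ⟨e, hk, he⟩ h_lt
    simp +decide only [val_ge_eq_zero, val_var, f _, State.set_of_ne, ne_eq, he] at h_lt
    exact ⟨e, by omega, he, h_lt⟩
  · rintro k s₁ f ⟨e, hk, he⟩ h_le
    simp +decide only [val_ge_ne_zero, val_var, f _, State.set_of_ne, ne_eq, he] at h_le
    have h_size := Nat.lt_size.2 h_le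
    exact ⟨k - 1, by omega, e + 1, by omega, by simp [State.set_apply, he, pow_succ, mul_two]⟩

theorem wp_checkFlow (hN : s Reg.nodes 0 = N) (hR : N < R) :
    wp R checkFlow (fun s' => s' Reg.infeasible 0 ≠ 0 ↔ ∃ u < N, ∃ v < N,
      s.mat Reg.flow u v ≠ 0 ∧ s Reg.bigCost 0 ≤ s.mat Reg.cost u v) s := by
  rw [checkFlow, wp_seq, wp_setVar]
  refine wp_forPairs_of_set (fun S s' => s' Reg.infeasible 0 ≠ 0 ↔ ∃ p ∈ S,
    s.mat Reg.flow p.1 p.2 ≠ 0 ∧ s Reg.bigCost 0 ≤ s.mat Reg.cost p.1 p.2)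
    (by simpa [State.set_apply] using hN) hR (fun S s₁ s₂ h h₁ => by simpa [h] using h₁)
    (by simp [State.set_apply]) (fun S u _ v _ s₁ f hu hv h₁ => ?_) fun s₁ _ h₁ => ?_
  · simp +decide only [wp_ite, wp_setVar, wp_skip, val_ge_ne_zero, val_ge_eq_zero, val_entry,
      val_var, f.mat Reg.flow, f.mat Reg.cost, f _, State.mat_set_of_ne, State.set_of_ne, hu, hv,
      Set.exists_mem_insert]
    refine ⟨fun hx => ⟨fun hc => ?_, fun hc => ?_⟩, fun hx => ?_⟩
    · simp [State.set_apply, hx, hc]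
    · simpa [hc.not_ge] using h₁
    · simpa [hx] using h₁
  · simpa [and_assoc, and_left_comm] using h₁

theorem wp_emit_none (h_output : s Reg.output 0 = 0) (h : ∀ T, ¬I.IsFeasible T) :
    wp R (emit 0) (HasCorrectOutput I) s := by
  refine wp_mono wp_emit fun s' hs' => ⟨none, h, ?_⟩
  simp [hs', output_eq_map, h_output, encodeAnswer]

theorem wp_emitAnswer {π : ℕ → ℕ} (h_output : s Reg.output 0 = 0)
    (h_vertices : s Reg.vertices 0 = I.n) (h_nodes : s Reg.nodes 0 = 3 * I.n + 2)
    (h_bigCost : s Reg.bigCost 0 = (3 * I.n + 2) * H + 1) (hc : I.IsNetCost D H (s.mat Reg.cost))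
    (hπ : IsCertificate (3 * I.n + 2) (s.mat Reg.cost) (s.mat Reg.flow) π)
    (hx : Balanced (3 * I.n + 2) (s.mat Reg.flow) I.netSupply I.netDemand)
    (hR : 3 * I.n + 2 < R) : wp R emitAnswer (HasCorrectOutput I) s := by
  refine wp_seq_frame (wp_checkFlow h_nodes hR) fun s₁ f h_check => ?_
  rw [h_bigCost] at h_check
  refine wp_ite.2 ⟨fun h_far => ?_, fun h_near => ?_⟩
  · obtain ⟨u, hu, v, hv, h_flow, h_cost⟩ := h_check.1 h_far
    have h_arc : ¬I.IsArc u v := fun h => by nlinarith [hc.le u v h]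
    exact wp_emit_none ((f.var Reg.output).trans h_output) fun T hT =>
      h_flow (hT.flow_eq_zero hc hπ hx hu hv h_arc)
  · refine wp_mono (wp_emitSolution ((f.var Reg.vertices).trans h_vertices) (by omega))
      fun s₂ h₂ => ⟨some (I.solutionOf (s.mat Reg.flow)), ?_, ?_⟩
    · refine isOptimal_solutionOf hc hπ hx fun u hu v hv h_arc => ?_
      by_contra h_flow
      exact h_check.2 ⟨u, hu, v, hv, h_flow, (hc.far u hu v hv h_arc).ge⟩ h_near
    · rw [h₂, f.mat Reg.flow, output_eq_map, f.var Reg.output, h_output]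
      rfl

theorem State.IsPrepared.isPartialFlow (h : s.IsPrepared I D H)
    (h_le : I.totalDemand ≤ I.totalSupply + I.m) :
    s.IsPartialFlow (3 * I.n + 2) I.netSupply I.netDemand where
  certified := ⟨fun u _ v _ => by simp [h.potential], fun u _ v _ hx => absurd (h.flow u v) hx⟩
  balanced w _ := by
    simp only [h.flow, h.hasBalances.supply, h.hasBalances.demand, Pi.add_apply,
      Finset.sum_const_zero]
    ring
  sum_eq := by
    rw [h.hasBalances.supply, h.hasBalances.demand, sum_netSupply h_le, sum_netDemand]

theorem wp_mcfoProgram (hR : 3 * I.n + 2 < R)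
    (hR_size : Nat.size (I.totalSupply + I.m) * (2 * (3 * I.n + 2) + 1) + 1 < R) :
    wp R mcfoProgram (HasCorrectOutput I) (initial I.encode) := by
  refine wp_seq_frame (wp_prepare hR) fun s _ ⟨D, H, h⟩ => ?_
  obtain ⟨h_supply, -, h_totalDemand, h_totalSupply⟩ := h.hasBalances
  simp only [wp_ite, val_ge_ne_zero, val_ge_eq_zero, val_var, h_totalDemand, h_totalSupply]
  refine ⟨fun h_le => ?_, fun h_lt => wp_emit_none h.output fun T hT =>
    h_lt.not_ge hT.totalDemand_le⟩
  refine wp_seq_frame (wp_initScale (by rw [h_totalSupply]; nlinarith)) fun s₁ f₁ ⟨e, he, h₁⟩ => ?_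
  rw [h_totalSupply] at he h₁
  have h_flow := h.isPartialFlow h_le
  refine wp_seq_frame (wp_solve ((f₁.var Reg.nodes).trans h.nodes) (by omega) hR
    (P := I.netSupply) (Q := I.netDemand) ?_ h₁.1 ?_ ?_ ?_) fun s₂ f₂ ⟨⟨π, hπ⟩, hx⟩ => ?_
  · obtain ⟨h_cert, h_bal, h_sum⟩ := h_flow
    constructor <;> simpa +decide only [State.IsCertified, f₁.mat Reg.cost, f₁.mat Reg.flow, f₁ _]
  · simp only [f₁.mat Reg.flow, h.flow, dvd_zero, implies_true]
  · rw [f₁.array Reg.supply, h_supply, sum_netSupply h_le]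
    exact h₁.2
  · exact (Nat.add_le_add_right (Nat.mul_le_mul_right _ he) 1).trans_lt hR_size
  · rw [f₁.mat Reg.cost] at hπ
    obtain ⟨h_output, h_vertices, h_nodes, h_bigCost, hc⟩ := h
    apply wp_emitAnswer (D := D) (H := H) (π := π) <;>
      simpa +decide only [f₁.mat Reg.cost, f₂.mat Reg.cost, f₁ _, f₂ _]

end Correctness

theorem mcfoProgram_tame : mcfoProgram.tame = true := by decide

section BitSize

theorem size_sum_le_bitSize (l : List ℕ) : Nat.size l.sum ≤ bitSize l := by
  induction l with
  | nil => simp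
  | cons a l ih =>
    have h_add := size_add_le_max a l.sum
    simp only [List.sum_cons, bitSize, List.map_cons] at ih ⊢
    omega

theorem length_le_bitSize (l : List ℕ) : l.length ≤ bitSize l := by
  rw [bitSize, ← List.length_map (fun x => Nat.size x + 1)]
  exact List.length_le_sum_of_one_le _ (by simp)

theorem size_le_bitSize {l : List ℕ} {a : ℕ} (ha : a ∈ l) : Nat.size a ≤ bitSize l :=
  (Nat.size_le_size (List.le_sum_of_mem ha)).trans (size_sum_le_bitSize l)

theorem size_length_le_bitSize (l : List ℕ) : Nat.size l.length ≤ bitSize l :=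
  (Nat.size_le.2 Nat.lt_two_pow_self).trans (length_le_bitSize l)

theorem size_initial_le (l : List ℕ) (a i : ℕ) : Nat.size (initial l a i) ≤ bitSize l := by
  unfold initial
  split_ifs
  · obtain hi | hi := lt_or_ge i (l.length + 1)
    · rw [List.getD_eq_getElem _ _ hi]
      obtain h | h := List.mem_cons.1 (List.getElem_mem hi)
      · rw [h]
        exact size_length_le_bitSize l
      · exact size_le_bitSize h
    · rw [List.getD_eq_default _ _ hi]
      simp
  · simp

theorem bounded_initial {l : List ℕ} {X : ℕ} (h : bitSize l ≤ X) : (initial l).Bounded X X where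
  size_input_le i := (size_initial_le l 0 i).trans h
  size_le a i := (size_initial_le l a i).trans h

theorem solvableInPolyTime_of_wp {α : Type} {β : α → Type} {encodeInput : α → List ℕ}
    {encodeAnswer : (a : α) → β a → List ℕ} {Correct : (a : α) → β a → Prop} {c : Program}
    (hc : c.tame) (p : Polynomial ℕ) (hp : ∀ k, k ≤ p.eval k)
    (h : ∀ a, wp (p.eval (bitSize (encodeInput a))) c
      (fun s => ∃ b, Correct a b ∧ output s = encodeAnswer a b) (initial (encodeInput a))) :
    SolvableInPolyTime encodeInput encodeAnswer Correct := by
  refine ⟨c, (c.timeBound Polynomial.X).comp p, fun a => ?_⟩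
  obtain ⟨t, s, h_exec, ht, -, h_correct⟩ :=
    haltsWithin_of_wp hc Polynomial.eval_X.ge (bounded_initial (hp _)) (h a)
  exact ⟨t, s, h_exec, ht.trans_eq (Polynomial.eval_comp ..).symm, h_correct⟩

theorem n_le_bitSize (I : MCFOInstance) : I.n ≤ bitSize I.encode := by
  refine le_trans ?_ (length_le_bitSize _)
  rw [encode, List.length_append, List.length_append, List.length_append,
    length_flatMap_finRange (k := 2) fun i => length_if rfl rfl]
  omega

theorem size_totalSupply_add_le_bitSize (I : MCFOInstance) :
    Nat.size (I.totalSupply + I.m) ≤ bitSize I.encode := by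
  refine (Nat.size_le_size ?_).trans (size_sum_le_bitSize _)
  have h : I.totalSupply ≤ ((List.finRange I.n).flatMap
      fun v => if v ∈ I.F then [1, I.supply v] else [0, 0]).sum := by
    rw [totalSupply_eq, ← List.sum_ofFn, List.ofFn_eq_map, List.flatMap, List.sum_flatten,
      List.map_map]
    refine List.sum_le_sum fun i _ => ?_
    rw [supplyAt_coe]
    by_cases hi : i ∈ I.F <;> simp [hi]
  simp only [encode, List.sum_append, List.sum_cons, List.sum_nil]
  omega

end BitSize

end RAM

theorem mainTheorem5 :
    RAM.SolvableInPolyTime (β := fun I : MCFOInstance => Option (MCFOFlow I.n ℕ))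
      MCFOInstance.encode MCFOInstance.encodeAnswer MCFOInstance.IsCorrectAnswer := by
  let p : Polynomial ℕ := 6 * Polynomial.X ^ 2 + 6 * Polynomial.X + 4
  have hp (k : ℕ) : p.eval k = 6 * k ^ 2 + 6 * k + 4 := by simp [p]
  refine RAM.solvableInPolyTime_of_wp RAM.mcfoProgram_tame p (fun k => by rw [hp]; nlinarith)
    fun I => ?_
  have hn := RAM.n_le_bitSize I
  have h_size := RAM.size_totalSupply_add_le_bitSize I
  rw [hp]
  refine RAM.wp_mcfoProgram (by nlinarith) ?_
  calc Nat.size (I.totalSupply + I.m) * (2 * (3 * I.n + 2) + 1) + 1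
      ≤ RAM.bitSize I.encode * (2 * (3 * RAM.bitSize I.encode + 2) + 1) + 1 := by gcongr
    _ < 6 * RAM.bitSize I.encode ^ 2 + 6 * RAM.bitSize I.encode + 4 := by linarith
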